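/- Let $G=G(n,p)$ be the Erdős–Rényi random graph on $n$ labeled vertices $V$ with edge probability $p=2\log n/n$ (natural logarithm). A labeling assigns to every vertex $x$ a finite bit string $\mathcal L(x)\in\{0,1\}^*$; its total length is $\sum_{x\in V}|\mathcal L(x)|$. A query procedure $Q$ answers a query for a pair $(x,y)$ by a value $Q(x,y,\mathcal L(x),\mathcal L(y))\in\mathbb N\cup\{\infty\}$; it may depend on $n$ but is fixed before the graph is drawn (it sees only the queried pair and the two labels, not the graph). A labeling recovers all pairwise distances of $G$ exactly through $Q$ if $Q(x,y,\mathcal L(x),\mathcal L(y))=\mathrm{dist}_G(x,y)$ for all $x,y\in V$, where $\mathrm{dist}_G(x,y)=\infty$ if $y$ is not reachable from $x$. There is an absolute constant $c>0$ such that the following two statements hold. (1) For every choice of query procedures $Q_n$, $n\ge 1$, with probability tending to $1$ as $n\to\infty$ over the randomness of $G$, every labeling that recovers all pairwise distances of $G$ exactly through $Q_n$ has total length at least $c\,n^{3/2}/\log^4 n$. (2) With probability tending to $1$ as $n\to\infty$, every 2-hop cover of $G$ stores at least $c\,n^{3/2}/\log^4 n$ landmarks. Here a 2-hop cover consists of sets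 $L_F(x),L_B(x)\subseteq V$ of forward and backward landmarks for each $x\in V$ such that $\min_{z\in L_F(x)\cap L_B(y)}\big(\mathrm{dist}_G(x,z)+\mathrm{dist}_G(z,y)\big)=\mathrm{dist}_G(x,y)$ for all $x,y\in V$ (the minimum over the empty set being $\infty$), and the number of landmarks it stores is $\sum_{x\in V}|L_F(x)\cup L_B(x)|$. -/

import Mathlib

open Filter Topology

open scoped unitInterval

/-- The edge probability `2 log n / n` (natural logarithm) lies in the unit interval. -/
lemma two_log_div_mem_unitInterval (n : ℕ) : 2 * Real.log n / n ∈ I := by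
  refine ⟨div_nonneg (mul_nonneg zero_le_two (Real.log_natCast_nonneg n)) n.cast_nonneg, ?_⟩
  rcases Nat.eq_zero_or_pos n with rfl | hn
  · simp
  · have hpos : (0 : ℝ) < n := Nat.cast_pos.mpr hn
    have h1 := Real.log_le_sub_one_of_pos (half_pos hpos)
    rw [Real.log_div hpos.ne' two_ne_zero] at h1
    have h2 := Real.log_two_lt_d9
    rw [div_le_one hpos]
    linarith

/-- The edge probability `p = 2 log n / n`. -/
noncomputable def edgeProb (n : ℕ) : I :=
  ⟨2 * Real.log n / n, two_log_div_mem_unitInterval n⟩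

/-- The law of the Erdős–Rényi graph `G(n, 2 log n / n)` on the vertex set `Fin n`. -/
noncomputable def erdosRenyi (n : ℕ) : MeasureTheory.Measure (SimpleGraph (Fin n)) :=
  SimpleGraph.binomialRandom (Fin n) (edgeProb n)

/-- The query procedure of a labeling scheme on the vertex set `V`. A query for the pair `(x, y)`
is answered from the labels of `x` and of `y` (finite bit strings) alone, without accessing the
graph: the procedure is fixed independently of the graph. The answer `⊤` stands for
"`y` is not reachable from `x`". -/
abbrev LabelQuery (V : Type*) : Type _ :=
  V → V → List Bool → List Bool → ℕ∞

/-- The labeling `L : V → {0,1}*`, queried through `Q`, recovers all pairwise distances of `G`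
exactly. -/
def RecoversDistances {V : Type*} (Q : LabelQuery V) (G : SimpleGraph V)
    (L : V → List Bool) : Prop :=
  ∀ x y : V, Q x y (L x) (L y) = G.edist x y

/-- The total length `∑ x, |L x|`, in bits, of a labeling. -/
def totalLength {V : Type*} [Fintype V] (L : V → List Bool) : ℕ :=
  ∑ x, (L x).length

/-- The forward landmark sets `LF` and backward landmark sets `LB` form a 2-hop cover of `G`: for
all `x, y`, the minimum of `dist(x, z) + dist(z, y)` over the common landmarks `z ∈ LF x ∩ LB y`
(which is `⊤` if there is none) is the distance between `x` and `y`. -/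
def IsTwoHopCover {V : Type*} [DecidableEq V] (G : SimpleGraph V) (LF LB : V → Finset V) : Prop :=
  ∀ x y : V, (LF x ∩ LB y).inf (fun z ↦ G.edist x z + G.edist z y) = G.edist x y

/-- The number of landmarks stored, the forward and the backward landmark set of each vertex being
combined to a single set (so that the case `LF = LB` gives `∑ x, |LF x|`). -/
def numLandmarks {V : Type*} [Fintype V] [DecidableEq V] (LF LB : V → Finset V) : ℕ :=
  ∑ x, (LF x ∪ LB x).card

/-!
The lower bounds come from counting: the distances among `√n` suitable vertices of the random graph
carry so much randomness that short labels cannot describe them.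

Let `d = 2 log n` be the expected degree and let `k` be maximal with `d ^ (k + 1) ≤ √n`
(`exists_radius`). Take a set of `s ≈ √n` vertices `x i` and explore the balls of radius `k`
around all of them. The spheres bounding these balls have about `d ^ k` vertices each
(`expect_sphereCard_far_le`), most of which lie in no other ball (`expect_overlap_le`); these
vertices form the private spheres. The exploration never looks at a vertex pair between two
different private spheres, so, even if all other pairs are revealed as well (`explore`), these
free pairs are still independent edges with probability `p` (`expect_deferred`,
`explore_stopping`). If `x i` and `x j` are not already at distance at most `2 k + 1` in the
revealed part, then they are at distance at most `2 k + 1` in `G` if and only if there is an edge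
between their private spheres (`edist_le_iff_of_mem_openPairs`). So each such open pair
contributes an independent random bit, whose smaller probability is at least about `p d ^ (2 k) ≥
d ^ (-3)`. Since most pairs are open (`expect_few_openPairs_le`), any fixed matrix is the distance
matrix of the `x i` with probability at most `exp (-c₀ n / log ^ 3 n)`, apart from the unlikely
event that few pairs are open (`expect_outcome_le`, `expect_exists_matrix_le`).

A labeling of total length `T` restricts, on at least half of `≈ √n` disjoint blocks of `≈ √n`
vertices, to labels of total length `O(T / √n)` (`expect_short_labeling_le`). Over an alphabet of
polynomial size there are only `exp (O(T log n / √n) + √n log n)` such families of labels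
(`exists_finset_words`), and each yields one distance matrix through the query procedure. For `T ≤
c n ^ (3 / 2) / log ^ 4 n` the number of families times the probability of a matrix tends to zero
(`union_bound_le`). The blocks need not succeed simultaneously: the expected fraction of blocks
with a short description bounds the failure probability, so moment estimates suffice.

Bit strings are the case of the alphabet `Bool`. A 2-hop cover is a labeling with one letter
per landmark, over the alphabet `LandmarkEntry n` of size `O(n ^ 2)`
(`exists_labeling_of_isTwoHopCover`).

The sizes of balls and spheres are controlled by first and second moments only: given the ball of
radius `j`, the other vertices join in the next round independently, with probability
`1 - (1 - p) ^ m` for a sphere of size `m` (`expect_mul_prod_fresh`).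
-/

/-! ### Expectations over the random graph and deferred decisions -/

section RandomGraph

open MeasureTheory ProbabilityTheory

/-- The indicator of a proposition, as a real number. -/
noncomputable def ind (P : Prop) : ℝ := open scoped Classical in if P then 1 else 0

lemma ind_true {P : Prop} (h : P) : ind P = 1 := by simp [ind, h]

lemma ind_false {P : Prop} (h : ¬ P) : ind P = 0 := by simp [ind, h]

lemma ind_nonneg (P : Prop) : 0 ≤ ind P := by unfold ind; split_ifs <;> norm_num

lemma ind_le_one (P : Prop) : ind P ≤ 1 := by unfold ind; split_ifs <;> norm_num

lemma ind_mono {P Q : Prop} (h : P → Q) : ind P ≤ ind Q := by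
  by_cases hP : P
  · rw [ind_true hP, ind_true (h hP)]
  · rw [ind_false hP]; exact ind_nonneg Q

lemma ind_and (P Q : Prop) : ind (P ∧ Q) = ind P * ind Q := by
  by_cases hP : P <;> by_cases hQ : Q <;> simp [ind, hP, hQ]

lemma ind_not (P : Prop) : ind (¬ P) = 1 - ind P := by
  by_cases hP : P <;> simp [ind, hP]

lemma ind_mul_self (P : Prop) : ind P * ind P = ind P := by
  by_cases hP : P <;> simp [ind, hP]

lemma sum_ind {α : Type*} [Fintype α] (s : Finset α) : ∑ u, ind (u ∈ s) = (s.card : ℝ) := by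
  rw [← Finset.sum_subset (Finset.subset_univ s) fun u _ hu ↦ ind_false hu,
    Finset.sum_congr rfl fun u hu ↦ ind_true hu]
  simp

variable {V : Type*} [Fintype V] {p : I}

instance : MeasurableSingletonClass (SimpleGraph V) where
  measurableSet_singleton G := by
    have := SimpleGraph.measurable_edgeSet (V := V) (measurableSet_singleton G.edgeSet)
    convert this
    ext G'
    simp

open scoped Classical in
/-- The expectation of a function of the random graph `G(V, p)`. As `V` is finite, it is a finite
sum and no integrability is needed. -/
noncomputable def expect (p : I) : (SimpleGraph V → ℝ) →ₗ[ℝ] ℝ where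
  toFun f := ∑ G, (SimpleGraph.binomialRandom V p).real {G} * f G
  map_add' f g := by simp [mul_add, Finset.sum_add_distrib]
  map_smul' c f := by simp [Finset.mul_sum, mul_left_comm]

lemma expect_eq_integral (f : SimpleGraph V → ℝ) :
    expect p f = ∫ G, f G ∂(SimpleGraph.binomialRandom V p) := by
  classical
  rw [integral_fintype (Integrable.of_finite)]
  simp [expect]

lemma expect_mono {f g : SimpleGraph V → ℝ} (h : ∀ G, f G ≤ g G) :
    expect p f ≤ expect p g := by
  classical
  exact Finset.sum_le_sum fun G _ ↦ mul_le_mul_of_nonneg_left (h G) measureReal_nonneg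

lemma expect_nonneg {f : SimpleGraph V → ℝ} (h : ∀ G, 0 ≤ f G) : 0 ≤ expect p f := by
  classical
  exact Finset.sum_nonneg fun G _ ↦ mul_nonneg measureReal_nonneg (h G)

lemma expect_const (c : ℝ) : expect p (fun _ : SimpleGraph V ↦ c) = c := by
  simp [expect_eq_integral]

lemma expect_mul_left (c : ℝ) (f : SimpleGraph V → ℝ) :
    expect p (fun G ↦ c * f G) = c * expect p f := by
  simpa [Pi.smul_def] using (expect p).map_smul c f

lemma expect_add (f g : SimpleGraph V → ℝ) :
    expect p (fun G ↦ f G + g G) = expect p f + expect p g := (expect p).map_add f g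

lemma expect_sub (f g : SimpleGraph V → ℝ) :
    expect p (fun G ↦ f G - g G) = expect p f - expect p g := (expect p).map_sub f g

lemma expect_sum {ι : Type*} (s : Finset ι) (f : ι → SimpleGraph V → ℝ) :
    expect p (fun G ↦ ∑ i ∈ s, f i G) = ∑ i ∈ s, expect p (f i) := by
  rw [← map_sum]
  congr 1
  ext G
  simp

lemma measureReal_eq_expect (P : SimpleGraph V → Prop) :
    (SimpleGraph.binomialRandom V p).real {G | P G} = expect p (fun G ↦ ind (P G)) := by
  classical
  rw [expect_eq_integral, ← integral_indicator_one (Set.toFinite _).measurableSet]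
  exact integral_congr_ae (.of_forall fun G ↦ by by_cases h : P G <;> simp [ind, h])

/-- Markov's inequality. -/
lemma expect_ind_le_div {f : SimpleGraph V → ℝ} (h : ∀ G, 0 ≤ f G) {t : ℝ} (ht : 0 < t) :
    expect p (fun G ↦ ind (t ≤ f G)) ≤ expect p f / t := by
  rw [div_eq_inv_mul, ← expect_mul_left]
  refine expect_mono fun G ↦ ?_
  by_cases hG : t ≤ f G
  · rw [ind_true hG, ← div_eq_inv_mul, le_div_iff₀ ht]; linarith
  · rw [ind_false hG]; exact mul_nonneg (inv_nonneg.2 ht.le) (h G)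

/-- The function `f` of a graph depends only on which of the vertex pairs in `J` are edges. -/
def EdgeDetermined {V β : Type*} (f : SimpleGraph V → β) (J : Set (Sym2 V)) : Prop :=
  ∀ G G' : SimpleGraph V, (∀ e ∈ J, e ∈ G.edgeSet ↔ e ∈ G'.edgeSet) → f G = f G'

/-- The random graph as a function of independent edge indicators. -/
lemma expect_eq_integral_pi (f : SimpleGraph V → ℝ) :
    expect p f = ∫ ω : Sym2 V → Prop, f (SimpleGraph.fromEdgeSet {e | ω e})
      ∂(Measure.infinitePi fun e : Sym2 V ↦
        unitInterval.toNNReal p • Measure.dirac (e ∈ (Sym2.diagSet : Set (Sym2 V))ᶜ) +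
          unitInterval.toNNReal (σ p) • Measure.dirac False) := by
  rw [expect_eq_integral, SimpleGraph.binomialRandom_eq_map, integral_map, setBernoulli_eq_map,
    integral_map]
  · exact (MeasurableEquiv.setOfPred).measurable.aemeasurable
  · exact (Measurable.of_discrete).aestronglyMeasurable
  · exact SimpleGraph.measurable_fromEdgeSet.aemeasurable
  · exact (Measurable.of_discrete).aestronglyMeasurable

/-- Functions determined by disjoint sets of vertex pairs are uncorrelated. -/
lemma expect_mul_of_disjoint {f g : SimpleGraph V → ℝ} {J K : Set (Sym2 V)}
    (hf : EdgeDetermined f J) (hg : EdgeDetermined g K) (hJK : Disjoint J K) :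
    expect p (fun G ↦ f G * g G) = expect p f * expect p g := by
  classical
  simp only [expect_eq_integral_pi]
  set P := (Measure.infinitePi fun e : Sym2 V ↦
        unitInterval.toNNReal p • Measure.dirac (e ∈ (Sym2.diagSet : Set (Sym2 V))ᶜ) +
          unitInterval.toNNReal (σ p) • Measure.dirac False) with hP
  have hind : iIndepFun (fun (e : Sym2 V) (ω : Sym2 V → Prop) ↦ ω e) P :=
    iIndepFun_infinitePi (X := fun _ ↦ id) (fun _ ↦ measurable_id)
  have h2 := hind.indepFun_finset J.toFinset K.toFinset (by simpa using hJK)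
    (fun e ↦ measurable_pi_apply e)
  -- a function determined by `L` is a function of the indicators of the pairs in `L`
  have key : ∀ (L : Set (Sym2 V)) (h : SimpleGraph V → ℝ), EdgeDetermined h L → ∀ ω : Sym2 V → Prop,
      h (SimpleGraph.fromEdgeSet {e | ω e}) = (fun ρ : L.toFinset → Prop ↦
        h (SimpleGraph.fromEdgeSet {e | ∃ he : e ∈ L.toFinset, ρ ⟨e, he⟩}))
        (fun e : L.toFinset ↦ ω e) := by
    intro L h hL ω
    refine hL _ _ fun e he ↦ ?_
    simp [he]
  have h3 := h2.comp (φ := fun ρ : J.toFinset → Prop ↦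
        f (SimpleGraph.fromEdgeSet {e | ∃ he : e ∈ J.toFinset, ρ ⟨e, he⟩}))
      (ψ := fun ρ : K.toFinset → Prop ↦
        g (SimpleGraph.fromEdgeSet {e | ∃ he : e ∈ K.toFinset, ρ ⟨e, he⟩}))
      .of_discrete .of_discrete
  have h4 := h3.integral_fun_mul_eq_mul_integral
    (Measurable.of_discrete).aestronglyMeasurable (Measurable.of_discrete).aestronglyMeasurable
  simp only [Function.comp_def] at h4
  refine Eq.trans (integral_congr_ae (.of_forall fun ω ↦ ?_)) (h4.trans ?_)
  · exact congrArg₂ (· * ·) (key J f hf ω) (key K g hg ω)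
  · exact congrArg₂ (· * ·) (integral_congr_ae (.of_forall fun ω ↦ (key J f hf ω).symm))
      (integral_congr_ae (.of_forall fun ω ↦ (key K g hg ω).symm))

lemma expect_ind_mem_edgeSet {e : Sym2 V} (he : ¬ e.IsDiag) :
    expect p (fun G ↦ ind (e ∈ G.edgeSet)) = p := by
  classical
  rw [expect_eq_integral_pi]
  have : ∀ ω : Sym2 V → Prop,
      ind (e ∈ (SimpleGraph.fromEdgeSet {e | ω e}).edgeSet) = (fun q : Prop ↦ ind q) (ω e) := by
    intro ω
    simp [he]
  simp only [this]
  rw [← integral_map (φ := fun ω : Sym2 V → Prop ↦ ω e) (f := fun q : Prop ↦ ind q)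
    (measurable_pi_apply e).aemeasurable (Measurable.of_discrete).aestronglyMeasurable,
    Measure.infinitePi_map_eval, integral_add_measure, integral_smul_nnreal_measure,
    integral_smul_nnreal_measure,
    integral_dirac, integral_dirac]
  · simp [ind, he, NNReal.smul_def]
  · exact Integrable.of_finite
  · exact Integrable.of_finite

lemma expect_prod_of_disjoint {ι : Type*} (s : Finset ι) {f : ι → SimpleGraph V → ℝ}
    {J : ι → Set (Sym2 V)} (hf : ∀ i ∈ s, EdgeDetermined (f i) (J i))
    (hJ : ∀ i ∈ s, ∀ j ∈ s, i ≠ j → Disjoint (J i) (J j)) :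
    expect p (fun G ↦ ∏ i ∈ s, f i G) = ∏ i ∈ s, expect p (f i) := by
  classical
  induction s using Finset.induction_on with
  | empty => simp [expect_const]
  | insert a s ha ih =>
    simp only [Finset.prod_insert ha]
    rw [expect_mul_of_disjoint (hf a (by simp)) (K := ⋃ i ∈ s, J i), ih]
    · exact fun i hi ↦ hf i (by simp [hi])
    · exact fun i hi j hj ↦ hJ i (by simp [hi]) j (by simp [hj])
    · intro G G' h
      refine Finset.prod_congr rfl fun i hi ↦ hf i (by simp [hi]) G G' fun e he ↦ h e ?_
      simp only [Set.mem_iUnion]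
      exact ⟨i, hi, he⟩
    · simp only [Set.disjoint_iUnion_right]
      intro i hi
      exact hJ a (by simp) i (by simp [hi]) (by rintro rfl; exact ha hi)

/-- The probability that none of the vertex pairs in `F` is an edge. -/
lemma expect_no_edge (F : Finset (Sym2 V)) (hF : ∀ e ∈ F, ¬ e.IsDiag) :
    expect p (fun G ↦ ind (∀ e ∈ F, e ∉ G.edgeSet)) = (1 - p : ℝ) ^ F.card := by
  classical
  have h1 : (fun G : SimpleGraph V ↦ ind (∀ e ∈ F, e ∉ G.edgeSet)) =
      fun G ↦ ∏ e ∈ F, (1 - ind (e ∈ G.edgeSet)) := by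
    ext G
    simp only [← ind_not]
    by_cases h : ∀ e ∈ F, e ∉ G.edgeSet
    · rw [ind_true h, Finset.prod_eq_one fun e he ↦ ind_true (h e he)]
    · rw [ind_false h]
      push Not at h
      obtain ⟨e, he, he'⟩ := h
      exact (Finset.prod_eq_zero he (ind_false (by simpa using he'))).symm
  rw [h1, expect_prod_of_disjoint F (J := fun e ↦ {e})]
  · rw [← Finset.prod_const]
    refine Finset.prod_congr rfl fun e he ↦ ?_
    rw [expect_sub, expect_const, expect_ind_mem_edgeSet (hF e he)]
  · intro e _ G G' h
    simp only [h e rfl]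
  · intro e _ e' _ hne
    simpa using hne

lemma expect_exists_edge (F : Finset (Sym2 V)) (hF : ∀ e ∈ F, ¬ e.IsDiag) :
    expect p (fun G ↦ ind (∃ e ∈ F, e ∈ G.edgeSet)) = 1 - (1 - p : ℝ) ^ F.card := by
  rw [← expect_no_edge F hF]
  nth_rewrite 1 [← expect_const (V := V) (p := p) 1]
  rw [← expect_sub]
  congr 1
  ext G
  rw [← ind_not]
  congr 1
  push Not
  rfl

/-- The principle of deferred decisions: if the value of `κ` is determined by the vertex pairs in
`J (κ G)` that it exposes, then, given that value, the pairs outside `J (κ G)` are still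
independent of each other and of the exposed ones. -/
lemma expect_deferred {K : Type*} (κ : SimpleGraph V → K) (J : K → Set (Sym2 V))
    (hκ : ∀ G G', (∀ e ∈ J (κ G), e ∈ G.edgeSet ↔ e ∈ G'.edgeSet) → κ G' = κ G)
    (h : K → ℝ) (g : K → SimpleGraph V → ℝ)
    (hg : ∀ G, EdgeDetermined (g (κ G)) (J (κ G))ᶜ) :
    expect p (fun G ↦ h (κ G) * g (κ G) G) = expect p (fun G ↦ h (κ G) * expect p (g (κ G))) := by
  classical
  have split : ∀ F : K → SimpleGraph V → ℝ, expect p (fun G ↦ h (κ G) * F (κ G) G) =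
      ∑ k ∈ Finset.univ.image κ, h k * expect p (fun G ↦ ind (κ G = k) * F k G) := by
    intro F
    simp only [← expect_mul_left]
    rw [← expect_sum]
    congr 1
    ext G
    rw [Finset.sum_eq_single (κ G)]
    · simp [ind]
    · intro k _ hk
      simp [ind, hk.symm]
    · simp
  rw [split, split (fun k _ ↦ expect p (g k))]
  refine Finset.sum_congr rfl fun k hk ↦ ?_
  obtain ⟨G₀, -, rfl⟩ := Finset.mem_image.1 hk
  have hdet : EdgeDetermined (fun G ↦ ind (κ G = κ G₀)) (J (κ G₀)) := by
    intro G G' hGG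
    have hiff : κ G = κ G₀ ↔ κ G' = κ G₀ := by
      constructor
      · intro hG
        rw [← hG] at hGG ⊢
        exact hκ G G' hGG
      · intro hG
        rw [← hG] at hGG ⊢
        exact hκ G' G fun e he ↦ (hGG e he).symm
    simp only [hiff]
  rw [expect_mul_of_disjoint hdet (hg G₀) disjoint_compl_right]
  congr 1
  rw [mul_comm, ← expect_mul_left]
  simp only [mul_comm]

end RandomGraph

/-! ### Balls and distances -/

section Balls

open MeasureTheory ProbabilityTheory

variable {V : Type*}

lemma SimpleGraph.edist_le_add_one_iff (G : SimpleGraph V) (a v : V) (j : ℕ) :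
    G.edist a v ≤ (j + 1 : ℕ) ↔ ∃ u, G.edist a u ≤ j ∧ (u = v ∨ G.Adj u v) := by
  constructor
  · intro h
    obtain ⟨w, hw⟩ := SimpleGraph.exists_walk_of_edist_ne_top
      (ne_top_of_le_ne_top (ENat.natCast_ne_top _) h)
    rw [← hw, Nat.cast_le] at h
    rcases Nat.eq_zero_or_pos w.length with h0 | h0
    · have := SimpleGraph.Walk.eq_of_length_eq_zero h0
      subst this
      exact ⟨a, by simp, Or.inl rfl⟩
    · have hnil : ¬ w.Nil := by
        rw [← SimpleGraph.Walk.length_eq_zero_iff]; omega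
      refine ⟨w.penultimate, ?_, Or.inr (w.adj_penultimate hnil)⟩
      refine (SimpleGraph.edist_le w.dropLast).trans ?_
      rw [SimpleGraph.Walk.length_dropLast]
      exact_mod_cast (by omega)
  · rintro ⟨u, hu, rfl | hadj⟩
    · exact hu.trans (by exact_mod_cast Nat.le_succ j)
    · refine (SimpleGraph.edist_triangle (v := u)).trans ?_
      rw [SimpleGraph.edist_eq_one_iff_adj.2 hadj]
      push_cast
      exact add_le_add_left hu 1

/-- Distances up to `j` from `a` only depend on the edges at vertices at distance less than `j`. -/
lemma SimpleGraph.edist_le_congr {G G' : SimpleGraph V} {a : V} {j : ℕ}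
    (h : ∀ u v, G.edist a u < j → (G.Adj u v ↔ G'.Adj u v)) {i : ℕ} (hi : i ≤ j) (v : V) :
    G.edist a v ≤ i ↔ G'.edist a v ≤ i := by
  induction i generalizing v with
  | zero => simp
  | succ i ih =>
    rw [SimpleGraph.edist_le_add_one_iff, SimpleGraph.edist_le_add_one_iff]
    refine exists_congr fun u ↦ ?_
    rw [← ih (by omega)]
    refine and_congr_right fun hu ↦ or_congr_right (h u v (hu.trans_lt ?_))
    exact_mod_cast (by omega : i < j)

/-- A path of length at most `k + l + 1` has an edge (or a vertex) in its middle. -/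
lemma SimpleGraph.exists_of_edist_le {G : SimpleGraph V} {a b : V} {k l : ℕ}
    (h : G.edist a b ≤ (k + l + 1 : ℕ)) :
    ∃ u v, G.edist a u ≤ k ∧ G.edist b v ≤ l ∧ (u = v ∨ G.Adj u v) := by
  induction l generalizing b with
  | zero =>
    obtain ⟨u, hu, huv⟩ := (G.edist_le_add_one_iff a b k).1 h
    exact ⟨u, b, hu, by simp, huv⟩
  | succ l ih =>
    obtain ⟨w, hw, hwb⟩ := (G.edist_le_add_one_iff a b (k + l + 1)).1 h
    obtain ⟨u, v, hu, hv, huv⟩ := ih hw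
    refine ⟨u, v, hu, ?_, huv⟩
    rw [SimpleGraph.edist_comm, SimpleGraph.edist_le_add_one_iff]
    exact ⟨w, by rwa [SimpleGraph.edist_comm], hwb⟩

variable [Fintype V]

open scoped Classical in
/-- The vertices at distance at most `j` from `a`. -/
noncomputable def cball (G : SimpleGraph V) (a : V) (j : ℕ) : Finset V :=
  {v | G.edist a v ≤ j}

open scoped Classical in
/-- The vertices at distance less than `j` from `a`. -/
noncomputable def oball (G : SimpleGraph V) (a : V) (j : ℕ) : Finset V :=
  {v | G.edist a v < j}

@[simp] lemma mem_cball {G : SimpleGraph V} {a v : V} {j : ℕ} :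
    v ∈ cball G a j ↔ G.edist a v ≤ j := by simp [cball]

@[simp] lemma mem_oball {G : SimpleGraph V} {a v : V} {j : ℕ} :
    v ∈ oball G a j ↔ G.edist a v < j := by simp [oball]

lemma oball_succ (G : SimpleGraph V) (a : V) (j : ℕ) : oball G a (j + 1) = cball G a j := by
  ext v
  rw [mem_oball, mem_cball, Nat.cast_add, Nat.cast_one, ENat.lt_natCast_add_one_iff]

/-- The pair of balls that a breadth first search from `a` knows after `j` rounds, when it has
looked at the neighbours of all vertices at distance less than `j`. -/
noncomputable def bfs (a : V) (j : ℕ) (G : SimpleGraph V) : Finset V × Finset V :=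
  (oball G a j, cball G a j)

lemma bfs_congr {G G' : SimpleGraph V} {a : V} {j : ℕ}
    (h : ∀ u ∈ oball G a j, ∀ v, (G.Adj u v ↔ G'.Adj u v)) : bfs a j G' = bfs a j G := by
  have key : ∀ i ≤ j, ∀ v, G.edist a v ≤ i ↔ G'.edist a v ≤ i := fun i hi v ↦
    SimpleGraph.edist_le_congr (fun u w hu ↦ h u (mem_oball.2 hu) w) hi v
  refine Prod.ext ?_ ?_
  · ext v
    cases j with
    | zero => simp [bfs]
    | succ j => simp only [bfs, oball_succ, mem_cball, key j (Nat.le_succ j)]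
  · ext v
    simp only [bfs, mem_cball, key j le_rfl]

lemma mem_cball_succ_of_notMem {G : SimpleGraph V} {a u : V} {j : ℕ} (hu : u ∉ cball G a j) :
    u ∈ cball G a (j + 1) ↔ ∃ w, w ∈ cball G a j ∧ w ∉ oball G a j ∧ G.Adj w u := by
  rw [mem_cball, SimpleGraph.edist_le_add_one_iff]
  constructor
  · rintro ⟨w, hw, rfl | hadj⟩
    · exact absurd (mem_cball.2 hw) hu
    · refine ⟨w, mem_cball.2 hw, fun hw' ↦ hu ?_, hadj⟩
      cases j with
      | zero => simp at hw'
      | succ j =>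
        rw [oball_succ, mem_cball] at hw'
        rw [mem_cball, SimpleGraph.edist_le_add_one_iff]
        exact ⟨w, hw', Or.inr hadj⟩
  · rintro ⟨w, hw, -, hadj⟩
    exact ⟨w, mem_cball.1 hw, Or.inr hadj⟩

end Balls

/-! ### One round of breadth first search -/

section Exploration

open MeasureTheory ProbabilityTheory

variable {V : Type*} [Fintype V] {p : I}

open scoped Classical in
/-- The vertex pairs that would connect a new vertex `u` to the boundary sphere of the explored
ball. -/
noncomputable def links {V : Type*} (k : Finset V × Finset V) (u : V) : Finset (Sym2 V) :=
  (k.2 \ k.1).image fun w ↦ s(w, u)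

/-- The indicator of the event that `u` is reached exactly in round `j + 1`. -/
noncomputable def fresh (a : V) (j : ℕ) (u : V) (G : SimpleGraph V) : ℝ :=
  ind (u ∈ cball G a (j + 1) ∧ u ∉ cball G a j)

open scoped Classical in
/-- The conditional probability that a given new vertex is reached in the next round. -/
noncomputable def reachProb {V : Type*} (p : I) (k : Finset V × Finset V) : ℝ :=
  1 - (1 - p : ℝ) ^ (k.2 \ k.1).card

lemma fresh_eq (a : V) (j : ℕ) (u : V) (G : SimpleGraph V) :
    fresh a j u G = ind (u ∉ (bfs a j G).2) * ind (∃ e ∈ links (bfs a j G) u, e ∈ G.edgeSet) := by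
  rw [fresh, ← ind_and]
  congr 1
  simp only [eq_iff_iff]
  constructor
  · rintro ⟨h1, h2⟩
    obtain ⟨w, hw, hw', hadj⟩ := (mem_cball_succ_of_notMem h2).1 h1
    classical
    exact ⟨h2, s(w, u), Finset.mem_image_of_mem _ (Finset.mem_sdiff.2 ⟨hw, hw'⟩), hadj⟩
  · rintro ⟨h2, e, he, he'⟩
    refine ⟨(mem_cball_succ_of_notMem h2).2 ?_, h2⟩
    simp only [links, Finset.mem_image, Finset.mem_sdiff] at he
    obtain ⟨w, ⟨hw, hw'⟩, rfl⟩ := he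
    exact ⟨w, hw, hw', he'⟩

lemma expect_links {k : Finset V × Finset V} {u : V} (hu : u ∉ k.2) :
    expect p (fun G ↦ ind (∃ e ∈ links k u, e ∈ G.edgeSet)) = reachProb p k := by
  classical
  rw [expect_exists_edge, reachProb, links, Finset.card_image_of_injective]
  · intro w w' h
    exact Sym2.congr_left.1 h
  · intro e he
    simp only [links, Finset.mem_image, Finset.mem_sdiff] at he
    obtain ⟨w, ⟨hw, -⟩, rfl⟩ := he
    simp only [Sym2.mk_isDiag_iff]
    rintro rfl
    exact hu hw

lemma edgeDetermined_links {V : Type*} (k : Finset V × Finset V) (u : V) :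
    EdgeDetermined (fun G : SimpleGraph V ↦ ind (∃ e ∈ links k u, e ∈ G.edgeSet)) (links k u) := by
  intro G G' h
  exact congrArg ind (propext (exists_congr fun e ↦ and_congr_right fun he ↦ h e he))

lemma links_disjoint {V : Type*} {k : Finset V × Finset V} (hk : k.1 ⊆ k.2) {u : V} (hu : u ∉ k.2) :
    Disjoint (links k u : Set (Sym2 V)) {e | ∃ w ∈ k.1, w ∈ e} := by
  classical
  rw [Set.disjoint_left]
  rintro e he ⟨w, hw, hwe⟩
  simp only [links, Finset.coe_image, Set.mem_image, Finset.mem_coe, Finset.mem_sdiff] at he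
  obtain ⟨w', ⟨-, hw'⟩, rfl⟩ := he
  rcases Sym2.mem_iff.1 hwe with rfl | rfl
  · exact hw' hw
  · exact hu (hk hw)

lemma bfs_fst_subset (a : V) (j : ℕ) (G : SimpleGraph V) : (bfs a j G).1 ⊆ (bfs a j G).2 := by
  intro v hv
  simp only [bfs, mem_oball, mem_cball] at *
  exact hv.le

lemma bfs_stopping (a : V) (j : ℕ) (G G' : SimpleGraph V)
    (h : ∀ e ∈ {e : Sym2 V | ∃ w ∈ (bfs a j G).1, w ∈ e}, e ∈ G.edgeSet ↔ e ∈ G'.edgeSet) :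
    bfs a j G' = bfs a j G :=
  bfs_congr fun u hu v ↦ h s(u, v) ⟨u, hu, by simp⟩

lemma links_disjoint_links {V : Type*} {k : Finset V × Finset V} {u v : V} (huv : u ≠ v)
    (hu : u ∉ k.2) :
    Disjoint (links k u : Set (Sym2 V)) (links k v) := by
  classical
  rw [Set.disjoint_left]
  intro e he he'
  simp only [links, Finset.coe_image, Set.mem_image, Finset.mem_coe, Finset.mem_sdiff] at he he'
  obtain ⟨w, ⟨hw, hw'⟩, rfl⟩ := he
  obtain ⟨x, ⟨hx, hx'⟩, hxw⟩ := he'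
  rcases Sym2.eq_iff.1 hxw with ⟨-, h⟩ | ⟨h, -⟩
  · exact huv h.symm
  · exact hu (h ▸ hx)

/-- Given the first `j` rounds of the search, the remaining vertices are reached in the next round
independently of each other. -/
lemma expect_mul_prod_fresh (a : V) (j : ℕ) (T : Finset V) (h : Finset V × Finset V → ℝ) :
    expect p (fun G ↦ h (bfs a j G) * ∏ u ∈ T, fresh a j u G) =
      expect p (fun G ↦ h (bfs a j G) *
        ∏ u ∈ T, (ind (u ∉ (bfs a j G).2) * reachProb p (bfs a j G))) := by
  classical
  simp only [fresh_eq]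
  rw [expect_deferred (bfs a j) (fun k ↦ {e | ∃ w ∈ k.1, w ∈ e}) (bfs_stopping a j) h
    (fun k G ↦ ∏ u ∈ T, (ind (u ∉ k.2) * ind (∃ e ∈ links k u, e ∈ G.edgeSet)))]
  · congr 1
    ext G
    congr 1
    set k := bfs a j G
    simp only [Finset.prod_mul_distrib, expect_mul_left]
    by_cases hT : ∀ u ∈ T, u ∉ k.2
    · rw [expect_prod_of_disjoint T (J := fun u ↦ links k u)]
      · rw [Finset.prod_congr rfl fun u hu ↦ expect_links (hT u hu)]
      · exact fun u _ ↦ edgeDetermined_links k u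
      · exact fun u hu v _ huv ↦ links_disjoint_links huv (hT u hu)
    · push Not at hT
      obtain ⟨u, hu, hu'⟩ := hT
      rw [Finset.prod_eq_zero hu (ind_false (by simpa using hu'))]
      simp
  · intro G G₁ G₂ hG
    refine Finset.prod_congr rfl fun u _ ↦ ?_
    by_cases hu : u ∈ (bfs a j G).2
    · rw [ind_false (by simpa using hu)]
      simp
    · congr 1
      refine edgeDetermined_links _ u G₁ G₂ fun e he ↦ hG e ?_
      exact (links_disjoint (bfs_fst_subset a j G) hu).subset_compl_right he

lemma reachProb_nonneg {V : Type*} (k : Finset V × Finset V) : 0 ≤ reachProb p k := by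
  have := pow_le_one₀ (n := (by classical exact (k.2 \ k.1).card))
    (sub_nonneg.2 p.2.2) (sub_le_self 1 p.2.1)
  unfold reachProb
  linarith

lemma reachProb_le_sphere {V : Type*} [DecidableEq V] (k : Finset V × Finset V) :
    reachProb p k ≤ p * (k.2 \ k.1).card := by
  have := one_add_mul_le_pow (a := -(p : ℝ)) (by linarith [p.2.2]) (k.2 \ k.1).card
  have h2 : reachProb p k = 1 - (1 + -(p : ℝ)) ^ (k.2 \ k.1).card := by
    rw [← sub_eq_add_neg]; unfold reachProb; congr!
  rw [h2]
  linarith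

lemma reachProb_le {V : Type*} (k : Finset V × Finset V) : reachProb p k ≤ p * k.2.card := by
  classical
  refine (reachProb_le_sphere k).trans (mul_le_mul_of_nonneg_left ?_ p.2.1)
  exact_mod_cast Finset.card_le_card Finset.sdiff_subset

lemma le_reachProb {V : Type*} [DecidableEq V] (k : Finset V × Finset V) :
    (p : ℝ) * (k.2 \ k.1).card - (p : ℝ) ^ 2 * (k.2 \ k.1).card ^ 2 ≤ reachProb p k := by
  have h2 : reachProb p k = 1 - (1 - (p : ℝ)) ^ (k.2 \ k.1).card := by
    unfold reachProb; congr!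
  rw [h2]
  have hp0 : (0 : ℝ) ≤ p := p.2.1
  have hp1 : (p : ℝ) ≤ 1 := p.2.2
  set m := (k.2 \ k.1).card
  have h1 := one_add_mul_le_pow (a := (p : ℝ)) (by linarith) m
  have h3 : (1 - (p : ℝ)) ^ m * (1 + m * p) ≤ 1 := by
    calc (1 - (p : ℝ)) ^ m * (1 + m * p) ≤ (1 - (p : ℝ)) ^ m * (1 + p) ^ m :=
          mul_le_mul_of_nonneg_left h1 (pow_nonneg (by linarith) _)
      _ = (1 - (p : ℝ) ^ 2) ^ m := by rw [← mul_pow]; ring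
      _ ≤ 1 := pow_le_one₀ (by nlinarith) (by nlinarith)
  have hx : (0 : ℝ) ≤ m * p := by positivity
  -- `1 ≤ (1 + x) * (1 - x + x ^ 2)` for `x = m * p`
  have h4 : (1 - (p : ℝ)) ^ m * (1 + m * p) ≤ (1 - m * p + (m * p) ^ 2) * (1 + m * p) := by
    nlinarith [pow_nonneg hx 3]
  have := le_of_mul_le_mul_right h4 (by linarith)
  nlinarith

lemma fresh_mul_self (a : V) (j : ℕ) (u : V) (G : SimpleGraph V) :
    fresh a j u G * fresh a j u G = fresh a j u G := ind_mul_self _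

lemma expect_mul_fresh (a : V) (j : ℕ) (u : V) (h : Finset V × Finset V → ℝ) :
    expect p (fun G ↦ h (bfs a j G) * fresh a j u G) =
      expect p (fun G ↦ h (bfs a j G) * (ind (u ∉ (bfs a j G).2) * reachProb p (bfs a j G))) := by
  simpa using expect_mul_prod_fresh (p := p) a j {u} h

lemma expect_mul_fresh_le (a : V) (j : ℕ) (u : V) {h : Finset V × Finset V → ℝ}
    (hh : ∀ k, 0 ≤ h k) :
    expect p (fun G ↦ h (bfs a j G) * fresh a j u G) ≤
      p * expect p (fun G ↦ h (bfs a j G) * (cball G a j).card) := by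
  rw [expect_mul_fresh, ← expect_mul_left]
  refine expect_mono fun G ↦ ?_
  rw [mul_left_comm (p : ℝ)]
  refine mul_le_mul_of_nonneg_left ?_ (hh _)
  calc _ ≤ 1 * (p * (bfs a j G).2.card : ℝ) :=
        mul_le_mul (ind_le_one _) (reachProb_le _) (reachProb_nonneg _) zero_le_one
    _ = _ := one_mul _

lemma expect_mul_fresh_mul_fresh_le (a : V) (j : ℕ) {u v : V} (huv : u ≠ v)
    {h : Finset V × Finset V → ℝ} (hh : ∀ k, 0 ≤ h k) :
    expect p (fun G ↦ h (bfs a j G) * (fresh a j u G * fresh a j v G)) ≤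
      p ^ 2 * expect p (fun G ↦ h (bfs a j G) * (cball G a j).card ^ 2) := by
  classical
  have h1 := expect_mul_prod_fresh (p := p) a j {u, v} h
  simp only [Finset.prod_pair huv] at h1
  rw [h1, ← expect_mul_left]
  refine expect_mono fun G ↦ ?_
  rw [mul_left_comm ((p : ℝ) ^ 2)]
  refine mul_le_mul_of_nonneg_left ?_ (hh _)
  have h2 : ∀ u : V, ind (u ∉ (bfs a j G).2) * reachProb p (bfs a j G) ≤
      p * (cball G a j).card := fun u ↦
    calc _ ≤ 1 * (p * (bfs a j G).2.card : ℝ) :=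
          mul_le_mul (ind_le_one _) (reachProb_le _) (reachProb_nonneg _) zero_le_one
      _ = _ := one_mul _
  rw [← mul_pow, sq]
  exact mul_le_mul (h2 u) (h2 v) (mul_nonneg (ind_nonneg _) (reachProb_nonneg _))
    (mul_nonneg p.2.1 (Nat.cast_nonneg _))

lemma ind_mem_cball_succ (a : V) (j : ℕ) (u : V) (G : SimpleGraph V) :
    ind (u ∈ cball G a (j + 1)) = ind (u ∈ cball G a j) + fresh a j u G := by
  unfold fresh
  by_cases h : u ∈ cball G a j
  · have h' : u ∈ cball G a (j + 1) := by
      rw [mem_cball] at *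
      exact h.trans (by exact_mod_cast Nat.le_succ j)
    simp [ind, h, h']
  · simp [ind, h]

lemma card_cball_succ (a : V) (j : ℕ) (G : SimpleGraph V) :
    ((cball G a (j + 1)).card : ℝ) = (cball G a j).card + ∑ u, fresh a j u G := by
  simp only [← sum_ind, ind_mem_cball_succ, Finset.sum_add_distrib]

lemma cball_zero (G : SimpleGraph V) (a : V) : cball G a 0 = {a} := by
  ext v
  rw [mem_cball, Nat.cast_zero, nonpos_iff_eq_zero, SimpleGraph.edist_eq_zero_iff,
    Finset.mem_singleton, eq_comm]

end Exploration

/-! ### Moments of the sizes of balls and spheres -/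

section Moments

open MeasureTheory ProbabilityTheory

variable {V : Type*} [Fintype V] {p : I}

variable (V) in
/-- The growth rate `1 + |V| p`, an upper bound for the expected growth of a ball in one round. -/
noncomputable def growth (p : I) : ℝ := 1 + Fintype.card V * (p : ℝ)

lemma one_le_growth : 1 ≤ growth V p :=
  le_add_of_nonneg_right (mul_nonneg (Nat.cast_nonneg _) p.2.1)

lemma expect_card_cball_le (a : V) (j : ℕ) :
    expect p (fun G ↦ ((cball G a j).card : ℝ)) ≤ growth V p ^ j := by
  induction j with
  | zero => simp [cball_zero, expect_const]
  | succ j ih =>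
    simp only [card_cball_succ]
    rw [expect_add, expect_sum]
    have h1 : ∀ u : V, expect p (fresh a j u) ≤
        p * expect p (fun G ↦ ((cball G a j).card : ℝ)) := fun u ↦ by
      simpa using expect_mul_fresh_le (p := p) a j u (h := fun _ ↦ 1) (fun _ ↦ zero_le_one)
    have h2 := Finset.sum_le_sum fun u (_ : u ∈ Finset.univ) ↦ h1 u
    rw [Finset.sum_const, Finset.card_univ, nsmul_eq_mul] at h2
    calc _ ≤ growth V p * expect p (fun G ↦ ((cball G a j).card : ℝ)) := by
          unfold growth; linarith
      _ ≤ growth V p * growth V p ^ j :=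
          mul_le_mul_of_nonneg_left ih (zero_le_one.trans one_le_growth)
      _ = _ := (pow_succ' _ _).symm

lemma expect_fresh_le (a : V) (j : ℕ) (u : V) :
    expect p (fresh a j u) ≤ p * growth V p ^ j := by
  have h : expect p (fresh a j u) ≤ p * expect p (fun G ↦ ((cball G a j).card : ℝ)) := by
    simpa using expect_mul_fresh_le (p := p) a j u (h := fun _ ↦ 1) (fun _ ↦ zero_le_one)
  exact h.trans (mul_le_mul_of_nonneg_left (expect_card_cball_le a j) p.2.1)

lemma expect_mem_cball_le {a u : V} (hu : u ≠ a) (j : ℕ) :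
    expect p (fun G ↦ ind (u ∈ cball G a j)) ≤ growth V p ^ j / Fintype.card V := by
  have hn : (0 : ℝ) < Fintype.card V := by
    exact_mod_cast Fintype.card_pos_iff.2 ⟨a⟩
  induction j with
  | zero =>
    simp only [cball_zero, Finset.mem_singleton, hu, ind_false not_false, expect_const]
    positivity
  | succ j ih =>
    simp only [ind_mem_cball_succ]
    rw [expect_add]
    refine (add_le_add ih (expect_fresh_le a j u)).trans (le_of_eq ?_)
    rw [pow_succ]
    unfold growth
    field_simp

/-- A mixed second moment of the increments of a ball. The diagonal contributes the term without
factor `p ^ 2`. -/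
lemma expect_fresh_mul_sum_fresh_le (a : V) (j : ℕ) (u : V) :
    expect p (fun G ↦ fresh a j u G * ∑ v, fresh a j v G) ≤
      p * growth V p ^ j + Fintype.card V * (p ^ 2 *
        expect p (fun G ↦ ((cball G a j).card : ℝ) ^ 2)) := by
  classical
  have hsq : 0 ≤ (p : ℝ) ^ 2 * expect p (fun G ↦ ((cball G a j).card : ℝ) ^ 2) :=
    mul_nonneg (sq_nonneg _) (expect_nonneg fun G ↦ sq_nonneg _)
  simp only [Finset.mul_sum]
  rw [expect_sum, ← Finset.add_sum_erase _ _ (Finset.mem_univ u)]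
  simp only [fresh_mul_self]
  refine add_le_add (expect_fresh_le a j u) ?_
  have h1 : ∀ v ∈ Finset.univ.erase u, expect p (fun G ↦ fresh a j u G * fresh a j v G) ≤
      p ^ 2 * expect p (fun G ↦ ((cball G a j).card : ℝ) ^ 2) := fun v hv ↦ by
    simpa using expect_mul_fresh_mul_fresh_le (p := p) a j (Finset.ne_of_mem_erase hv).symm
      (h := fun _ ↦ 1) (fun _ ↦ zero_le_one)
  refine (Finset.sum_le_card_nsmul _ _ _ h1).trans ?_
  rw [nsmul_eq_mul]
  refine mul_le_mul_of_nonneg_right ?_ hsq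
  exact_mod_cast (Finset.card_le_univ _)

lemma expect_mul_sum_fresh_le (a : V) (j : ℕ) (h : Finset V × Finset V → ℝ)
    (hh : ∀ k, 0 ≤ h k) :
    expect p (fun G ↦ h (bfs a j G) * ∑ v, fresh a j v G) ≤
      (growth V p - 1) * expect p (fun G ↦ h (bfs a j G) * (cball G a j).card) := by
  simp only [Finset.mul_sum]
  rw [expect_sum]
  refine (Finset.sum_le_card_nsmul _ _ _ fun v _ ↦ expect_mul_fresh_le a j v hh).trans
    (le_of_eq ?_)
  rw [nsmul_eq_mul, Finset.card_univ, growth]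
  ring

/-- Subtracting the last term on the right strengthens the claim enough for the induction on `j` to
close. -/
lemma expect_card_cball_sq_le (a : V) (j : ℕ) :
    expect p (fun G ↦ ((cball G a j).card : ℝ) ^ 2) ≤
      growth V p ^ (2 * j) * (1 + 1 / growth V p) - growth V p ^ j / growth V p := by
  have hD := one_le_growth (V := V) (p := p)
  have hD0 : 0 < growth V p := by linarith
  induction j with
  | zero => simp [cball_zero, expect_const]
  | succ j ih =>
    set M := expect p (fun G ↦ ((cball G a j).card : ℝ) ^ 2) with hM
    have hM0 : 0 ≤ M := expect_nonneg fun G ↦ sq_nonneg _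
    have h1 : ∀ G : SimpleGraph V, ((cball G a (j + 1)).card : ℝ) ^ 2 =
        ((cball G a j).card : ℝ) ^ 2 + (2 * ((cball G a j).card * ∑ v, fresh a j v G) +
          ∑ u, fresh a j u G * ∑ v, fresh a j v G) := by
      intro G
      rw [card_cball_succ, ← Finset.sum_mul]
      ring
    simp only [h1]
    rw [expect_add, expect_add, expect_mul_left, expect_sum]
    have h2 := expect_mul_sum_fresh_le (p := p) a j (fun k ↦ k.2.card)
      (fun k ↦ Nat.cast_nonneg _)
    simp only [bfs, ← sq] at h2
    have h3 := Finset.sum_le_card_nsmul Finset.univ _ _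
      fun u _ ↦ expect_fresh_mul_sum_fresh_le (p := p) a j u
    rw [nsmul_eq_mul, Finset.card_univ] at h3
    have hd : (Fintype.card V : ℝ) * p = growth V p - 1 := by unfold growth; ring
    have h4 : (Fintype.card V : ℝ) * (p * growth V p ^ j + Fintype.card V * (p ^ 2 * M)) =
        (growth V p - 1) * growth V p ^ j + (growth V p - 1) ^ 2 * M := by
      rw [← hd]; ring
    rw [← hM] at h2 h3 ⊢
    rw [h4] at h3
    calc _ ≤ M + (2 * ((growth V p - 1) * M) +
          ((growth V p - 1) * growth V p ^ j + (growth V p - 1) ^ 2 * M)) := by linarith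
      _ = growth V p ^ 2 * M + (growth V p - 1) * growth V p ^ j := by ring
      _ ≤ growth V p ^ 2 * (growth V p ^ (2 * j) * (1 + 1 / growth V p) -
            growth V p ^ j / growth V p) + (growth V p - 1) * growth V p ^ j := by
          gcongr
      _ = _ := by field_simp; ring

lemma expect_card_cball_sq_le' (a : V) (j : ℕ) :
    expect p (fun G ↦ ((cball G a j).card : ℝ) ^ 2) ≤ 2 * growth V p ^ (2 * j) := by
  have hD := one_le_growth (V := V) (p := p)
  have h1 : 1 / growth V p ≤ 1 := by
    rw [div_le_one (by linarith)]; exact hD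
  have h2 : 0 ≤ growth V p ^ j / growth V p := by positivity
  have h3 : 0 ≤ growth V p ^ (2 * j) := by positivity
  nlinarith [expect_card_cball_sq_le (p := p) a j]

lemma expect_mem_mul_card_le {a u : V} (hu : u ≠ a) (j : ℕ) :
    expect p (fun G ↦ ind (u ∈ cball G a j) * ((cball G a j).card : ℝ)) ≤
      3 * growth V p ^ (2 * j) / Fintype.card V := by
  have hD := one_le_growth (V := V) (p := p)
  have hn : (0 : ℝ) < Fintype.card V := by
    exact_mod_cast Fintype.card_pos_iff.2 ⟨a⟩
  induction j with
  | zero =>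
    simp only [cball_zero, Finset.mem_singleton, hu, ind_false not_false, zero_mul, expect_const]
    positivity
  | succ j ih =>
    set τ := expect p (fun G ↦ ind (u ∈ cball G a j) * ((cball G a j).card : ℝ)) with hτ
    set M := expect p (fun G ↦ ((cball G a j).card : ℝ) ^ 2) with hM
    have hM2 : M ≤ 2 * growth V p ^ (2 * j) := expect_card_cball_sq_le' a j
    have h1 : ∀ G : SimpleGraph V,
        ind (u ∈ cball G a (j + 1)) * ((cball G a (j + 1)).card : ℝ) =
        ind (u ∈ cball G a j) * (cball G a j).card +
        (ind (u ∈ cball G a j) * ∑ v, fresh a j v G + ((cball G a j).card * fresh a j u G +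
          fresh a j u G * ∑ v, fresh a j v G)) := by
      intro G
      rw [card_cball_succ, ind_mem_cball_succ]
      ring
    simp only [h1]
    rw [expect_add, expect_add, expect_add]
    have h2 := expect_mul_sum_fresh_le (p := p) a j (fun k ↦ ind (u ∈ k.2))
      (fun k ↦ ind_nonneg _)
    have h3 := expect_mul_fresh_le (p := p) a j u (h := fun k ↦ (k.2.card : ℝ))
      (fun k ↦ Nat.cast_nonneg _)
    simp only [bfs, ← sq] at h2 h3
    have h4 := expect_fresh_mul_sum_fresh_le (p := p) a j u
    rw [← hM] at h3 h4
    rw [← hτ] at h2 ⊢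
    have hd : (p : ℝ) = (growth V p - 1) / Fintype.card V := by unfold growth; field_simp; ring
    have h5 : (p : ℝ) * M + (p * growth V p ^ j + Fintype.card V * (p ^ 2 * M)) =
        (growth V p - 1) / Fintype.card V * (growth V p * M + growth V p ^ j) := by
      rw [hd]; field_simp; ring
    have h6 : growth V p * M + growth V p ^ j ≤ 3 * growth V p ^ (2 * j + 1) := by
      have e1 : growth V p ^ j ≤ growth V p ^ (2 * j + 1) := pow_le_pow_right₀ hD (by omega)
      have e2 : growth V p * M ≤ growth V p * (2 * growth V p ^ (2 * j)) := by gcongr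
      have e3 : growth V p * (2 * growth V p ^ (2 * j)) = 2 * growth V p ^ (2 * j + 1) := by ring
      linarith
    have h7 : 0 ≤ (growth V p - 1) / Fintype.card V := div_nonneg (by linarith) hn.le
    calc _ ≤ growth V p * τ + ((p : ℝ) * M +
          (p * growth V p ^ j + Fintype.card V * (p ^ 2 * M))) := by linarith
      _ ≤ growth V p * (3 * growth V p ^ (2 * j) / Fintype.card V) +
          (growth V p - 1) / Fintype.card V * (3 * growth V p ^ (2 * j + 1)) := by
        rw [h5]
        exact add_le_add (mul_le_mul_of_nonneg_left ih (by linarith))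
          (mul_le_mul_of_nonneg_left h6 h7)
      _ = _ := by field_simp; ring

/-- Two given vertices are both close to a third one with about the probability that independence
would give. -/
lemma expect_mem_mul_mem_le {a u v : V} (hu : u ≠ a) (hv : v ≠ a) (huv : u ≠ v) (j : ℕ) :
    expect p (fun G ↦ ind (u ∈ cball G a j) * ind (v ∈ cball G a j)) ≤
      3 * growth V p ^ (2 * j) / Fintype.card V ^ 2 := by
  have hD := one_le_growth (V := V) (p := p)
  have hn : (0 : ℝ) < Fintype.card V := by
    exact_mod_cast Fintype.card_pos_iff.2 ⟨a⟩
  induction j with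
  | zero =>
    simp only [cball_zero, Finset.mem_singleton, hu, ind_false not_false, zero_mul, expect_const]
    positivity
  | succ j ih =>
    have h1 : ∀ G : SimpleGraph V,
        ind (u ∈ cball G a (j + 1)) * ind (v ∈ cball G a (j + 1)) =
        ind (u ∈ cball G a j) * ind (v ∈ cball G a j) +
        (ind (u ∈ cball G a j) * fresh a j v G + (ind (v ∈ cball G a j) * fresh a j u G +
          fresh a j u G * fresh a j v G)) := by
      intro G
      simp only [ind_mem_cball_succ]
      ring
    simp only [h1]
    rw [expect_add, expect_add, expect_add]
    have h2 := expect_mul_fresh_le (p := p) a j v (h := fun k ↦ ind (u ∈ k.2))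
      (fun k ↦ ind_nonneg _)
    have h3 := expect_mul_fresh_le (p := p) a j u (h := fun k ↦ ind (v ∈ k.2))
      (fun k ↦ ind_nonneg _)
    have h4 := expect_mul_fresh_mul_fresh_le (p := p) a j huv (h := fun _ ↦ 1)
      (fun _ ↦ zero_le_one)
    simp only [one_mul] at h4
    simp only [bfs] at h2 h3
    have hp : (0 : ℝ) ≤ p := p.2.1
    have h2' := h2.trans (mul_le_mul_of_nonneg_left (expect_mem_mul_card_le hu j) hp)
    have h3' := h3.trans (mul_le_mul_of_nonneg_left (expect_mem_mul_card_le hv j) hp)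
    have h4' := h4.trans (mul_le_mul_of_nonneg_left (expect_card_cball_sq_le' a j) (sq_nonneg _))
    have hd : (p : ℝ) = (growth V p - 1) / Fintype.card V := by unfold growth; field_simp; ring
    rw [hd] at h2' h3' h4'
    refine (add_le_add ih (add_le_add h2' (add_le_add h3' h4'))).trans ?_
    rw [le_div_iff₀ (by positivity)]
    field_simp
    have : growth V p ^ (2 * (j + 1)) = growth V p ^ (2 * j) * growth V p ^ 2 := by ring
    rw [this]
    nlinarith [pow_pos (zero_lt_one.trans_le hD) (2 * j), sq_nonneg (growth V p - 1)]

open scoped Classical in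
/-- The number of vertices at distance exactly `j` from `a`. -/
noncomputable def sphereCard (a : V) (j : ℕ) (G : SimpleGraph V) : ℝ :=
  (((bfs a j G).2 \ (bfs a j G).1).card : ℝ)

lemma sphereCard_le (a : V) (j : ℕ) (G : SimpleGraph V) :
    sphereCard a j G ≤ (cball G a j).card := by
  classical
  exact Nat.cast_le.2 (Finset.card_le_card (t := (bfs a j G).2) Finset.sdiff_subset)

lemma sphereCard_succ (a : V) (j : ℕ) (G : SimpleGraph V) :
    sphereCard a (j + 1) G = ∑ u, fresh a j u G := by
  classical
  simp only [sphereCard, ← sum_ind, fresh, bfs, oball_succ, Finset.mem_sdiff]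

lemma sphereCard_nonneg (a : V) (j : ℕ) (G : SimpleGraph V) : 0 ≤ sphereCard a j G :=
  Nat.cast_nonneg _

/-- Spheres grow in expectation by a factor close to `|V| p`. What is lost comes from vertices that
were already found and from those that are reached along several edges. -/
lemma expect_sphereCard_succ_ge (a : V) (j : ℕ) :
    (growth V p - 1) * expect p (sphereCard a j) -
      (growth V p - 1) * (2 * growth V p ^ (2 * j + 1) / Fintype.card V) ≤
    expect p (sphereCard a (j + 1)) := by
  classical
  have hD := one_le_growth (V := V) (p := p)
  have hn : (0 : ℝ) < Fintype.card V := by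
    exact_mod_cast Fintype.card_pos_iff.2 ⟨a⟩
  have hp : (0 : ℝ) ≤ p := p.2.1
  have h1 : expect p (sphereCard a (j + 1)) = expect p (fun G ↦
      (Fintype.card V - (cball G a j).card : ℝ) * reachProb p (bfs a j G)) := by
    rw [show sphereCard (V := V) a (j + 1) = fun G ↦ ∑ u, fresh a j u G from
      funext (sphereCard_succ a j), expect_sum]
    have h2 : ∀ u, expect p (fresh a j u) = expect p (fun G ↦
        ind (u ∉ (bfs a j G).2) * reachProb p (bfs a j G)) := fun u ↦ by
      simpa using expect_mul_fresh (p := p) a j u (fun _ ↦ 1)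
    simp only [h2]
    rw [← expect_sum]
    congr 1
    ext G
    rw [← Finset.sum_mul]
    congr 1
    simp only [ind_not, Finset.sum_sub_distrib, sum_ind]
    simp [bfs]
  have h3 : ∀ G : SimpleGraph V, (growth V p - 1) * sphereCard a j G -
      (p + Fintype.card V * p ^ 2) * ((cball G a j).card : ℝ) ^ 2 ≤
      (Fintype.card V - (cball G a j).card : ℝ) * reachProb p (bfs a j G) := by
    intro G
    have e1 : (p : ℝ) * sphereCard a j G - (p : ℝ) ^ 2 * sphereCard a j G ^ 2 ≤
      reachProb p (bfs a j G) := le_reachProb (p := p) (bfs a j G)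
    have e2 : reachProb p (bfs a j G) ≤ p * (cball G a j).card := reachProb_le (p := p) (bfs a j G)
    have e3 := sphereCard_le a j G
    have e4 := sphereCard_nonneg a j G
    have hW : (0 : ℝ) ≤ (cball G a j).card := Nat.cast_nonneg _
    have e5 := mul_le_mul_of_nonneg_left e1 hn.le
    have e6 := mul_le_mul_of_nonneg_left e2 hW
    have e7 : (Fintype.card V * p ^ 2 : ℝ) * sphereCard a j G ^ 2 ≤
      (Fintype.card V * p ^ 2) * ((cball G a j).card : ℝ) ^ 2 := by gcongr
    unfold growth
    linarith
  rw [h1]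
  refine le_trans ?_ (expect_mono h3)
  rw [expect_sub, expect_mul_left, expect_mul_left]
  refine sub_le_sub_left ?_ _
  have h4 := expect_card_cball_sq_le' (p := p) a j
  refine (mul_le_mul_of_nonneg_left h4 (by positivity)).trans (le_of_eq ?_)
  have hd : (p : ℝ) = (growth V p - 1) / Fintype.card V := by unfold growth; field_simp; ring
  rw [hd]
  field_simp
  ring

lemma expect_sphereCard_ge (a : V) {k : ℕ} {j : ℕ} (hjk : j ≤ k) (hd : 1 ≤ growth V p - 1) :
    (growth V p - 1) ^ j * (1 - j * (2 * growth V p ^ (2 * k + 1) / Fintype.card V)) ≤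
      expect p (sphereCard a j) := by
  have hn : (0 : ℝ) < Fintype.card V := by
    exact_mod_cast Fintype.card_pos_iff.2 ⟨a⟩
  have hD := one_le_growth (V := V) (p := p)
  induction j with
  | zero =>
    have : ∀ G : SimpleGraph V, sphereCard a 0 G = 1 := by
      intro G
      classical
      have h0 : oball G a 0 = ∅ := by ext v; simp
      simp [sphereCard, bfs, cball_zero, h0]
    simp [show sphereCard (V := V) a 0 = fun _ ↦ 1 from funext this, expect_const]
  | succ j ih =>
    refine le_trans ?_ (expect_sphereCard_succ_ge a j)
    have h1 := mul_le_mul_of_nonneg_left (ih (by omega)) (zero_le_one.trans hd)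
    have h2 : 2 * growth V p ^ (2 * j + 1) / Fintype.card V ≤
        2 * growth V p ^ (2 * k + 1) / Fintype.card V := by
      gcongr
      omega
    set ε := 2 * growth V p ^ (2 * k + 1) / Fintype.card V
    have hε : 0 ≤ ε := by positivity
    have h3 : 2 * growth V p ^ (2 * j + 1) / Fintype.card V ≤ (growth V p - 1) ^ j * ε :=
      h2.trans (le_mul_of_one_le_left hε (one_le_pow₀ hd))
    have h4 := mul_le_mul_of_nonneg_left h3 (zero_le_one.trans hd)
    refine le_trans (le_of_eq ?_) (sub_le_sub h1 h4)
    push_cast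
    ring

/-- The sphere of radius `k` has about the size `(|V| p) ^ k`: the first two moments of its size are
close to those of the constant `(|V| p) ^ k`. -/
lemma expect_sphereCard_far_le (a : V) {k : ℕ} {η : ℝ} (hd : 1 ≤ growth V p - 1) (hη : η ≤ 1)
    (h1 : growth V p ^ (2 * k) ≤ (1 + η) * (growth V p - 1) ^ (2 * k))
    (h2 : 1 / growth V p ≤ η)
    (h3 : k * (2 * growth V p ^ (2 * k + 1) / Fintype.card V) ≤ η) :
    expect p (fun G ↦ ind ((growth V p - 1) ^ k / 2 ≤ |sphereCard a k G - (growth V p - 1) ^ k|)) ≤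
      20 * η := by
  have hD := one_le_growth (V := V) (p := p)
  have hη0 : 0 ≤ η := (by positivity : 0 ≤ 1 / growth V p).trans h2
  set d := growth V p - 1
  have hd0 : 0 < d ^ k := by positivity
  have e1 : expect p (fun G ↦ (sphereCard a k G - d ^ k) ^ 2) ≤ 5 * η * d ^ (2 * k) := by
    have f1 : ∀ G : SimpleGraph V, (sphereCard a k G - d ^ k) ^ 2 ≤
        (((cball G a k).card : ℝ) ^ 2 - 2 * d ^ k * sphereCard a k G) + d ^ (2 * k) := by
      intro G
      have := pow_le_pow_left₀ (sphereCard_nonneg a k G) (sphereCard_le a k G) 2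
      have e : d ^ (2 * k) = (d ^ k) ^ 2 := by rw [← pow_mul, mul_comm]
      rw [e]
      linarith
    refine (expect_mono f1).trans ?_
    rw [expect_add, expect_sub, expect_mul_left, expect_const]
    have f2 := expect_card_cball_sq_le (p := p) a k
    have f3 : 0 ≤ growth V p ^ k / growth V p := by positivity
    have f4 := expect_sphereCard_ge (p := p) a (le_refl k) hd
    have f5 : d ^ k * (1 - η) ≤ expect p (sphereCard a k) :=
      le_trans (mul_le_mul_of_nonneg_left (by linarith) hd0.le) f4
    have f6 : growth V p ^ (2 * k) * (1 + 1 / growth V p) ≤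
        (1 + η) * d ^ (2 * k) * (1 + η) := by
      gcongr
    have f7 := mul_le_mul_of_nonneg_left f5 (by positivity : 0 ≤ 2 * d ^ k)
    have e : d ^ (2 * k) = d ^ k * d ^ k := by rw [two_mul, pow_add]
    rw [e] at f6 ⊢
    nlinarith [mul_nonneg (mul_nonneg hη0 (sub_nonneg.2 hη)) (mul_pos hd0 hd0).le]
  have e2 : ∀ G : SimpleGraph V, ind (d ^ k / 2 ≤ |sphereCard a k G - d ^ k|) ≤
      ind ((d ^ k / 2) ^ 2 ≤ (sphereCard a k G - d ^ k) ^ 2) := fun G ↦ ind_mono fun h ↦ by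
    rw [← sq_abs (sphereCard a k G - d ^ k)]
    exact pow_le_pow_left₀ (by positivity) h 2
  refine (expect_mono e2).trans ((expect_ind_le_div (fun G ↦ sq_nonneg _) (by positivity)).trans ?_)
  rw [div_le_iff₀ (by positivity)]
  refine e1.trans (le_of_eq ?_)
  rw [mul_comm 2 k, pow_mul]
  ring

end Moments

/-! ### The edges between private spheres -/

section Fibres

open MeasureTheory ProbabilityTheory

variable {V ι : Type*} [Fintype V] {p : I}

open scoped Classical in
/-- The private part of the `i`-th sphere: the vertices on the boundary of the `i`-th explored ball
that lie in no other explored ball. -/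
noncomputable def privateSphere {V ι : Type*} (β : ι → Finset V × Finset V) (i : ι) : Finset V :=
  {a ∈ (β i).2 \ (β i).1 | ∀ j, j ≠ i → a ∉ (β j).2}

lemma mem_privateSphere {V ι : Type*} {β : ι → Finset V × Finset V} {i : ι} {a : V} :
    a ∈ privateSphere β i ↔ (a ∈ (β i).2 ∧ a ∉ (β i).1) ∧ ∀ j, j ≠ i → a ∉ (β j).2 := by
  simp [privateSphere]

lemma eq_of_mem_privateSphere {V ι : Type*} {β : ι → Finset V × Finset V} {i j : ι} {a : V}
    (hi : a ∈ privateSphere β i) (hj : a ∈ (β j).2) : j = i := by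
  by_contra hne
  exact (mem_privateSphere.1 hi).2 j hne hj

open scoped Classical in
/-- The vertex pairs between the private spheres of `q.1` and of `q.2`. -/
noncomputable def crossPairs {V ι : Type*} (β : ι → Finset V × Finset V) (q : ι × ι) :
    Finset (Sym2 V) :=
  (privateSphere β q.1 ×ˢ privateSphere β q.2).image fun ab ↦ s(ab.1, ab.2)

lemma mem_crossPairs {V ι : Type*} {β : ι → Finset V × Finset V} {q : ι × ι} {e : Sym2 V} :
    e ∈ crossPairs β q ↔ ∃ a ∈ privateSphere β q.1, ∃ b ∈ privateSphere β q.2, s(a, b) = e := by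
  simp [crossPairs, and_assoc]

/-- The vertex pairs between different private spheres. The exploration of the balls leaves these
pairs open. -/
def freePairs {V ι : Type*} (β : ι → Finset V × Finset V) : Set (Sym2 V) :=
  {e | ∃ q : ι × ι, q.1 ≠ q.2 ∧ e ∈ crossPairs β q}

/-- What is known about the graph `G` when everything is revealed except for the edges between
different private spheres of radius `k` around the vertices `x i`. -/
noncomputable def explore (x : ι → V) (k : ℕ) (G : SimpleGraph V) :
    (ι → Finset V × Finset V) × SimpleGraph V :=
  (fun i ↦ bfs (x i) k G, G.deleteEdges (freePairs fun i ↦ bfs (x i) k G))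

lemma notMem_oball_of_mem_freePairs {x : ι → V} {k : ℕ} {G : SimpleGraph V} {u v : V} {i : ι}
    (h : s(u, v) ∈ freePairs (explore x k G).1) : u ∉ oball G (x i) k := by
  obtain ⟨q, -, hq⟩ := h
  obtain ⟨a, ha, b, hb, hab⟩ := mem_crossPairs.1 hq
  have key : ∀ j (c : V), c ∈ privateSphere (explore x k G).1 j → c ∉ oball G (x i) k := by
    intro j c hc hmem
    rcases eq_or_ne i j with rfl | hij
    · exact (mem_privateSphere.1 hc).1.2 hmem
    · exact (mem_privateSphere.1 hc).2 i hij (bfs_fst_subset (x i) k G hmem)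
  rcases Sym2.eq_iff.1 hab with ⟨rfl, -⟩ | ⟨-, rfl⟩
  · exact key _ _ ha
  · exact key _ _ hb

/-- Changing the graph on free pairs does not change what was explored. -/
lemma explore_stopping (x : ι → V) (k : ℕ) (G G' : SimpleGraph V)
    (h : ∀ e ∈ (freePairs (explore x k G).1)ᶜ, e ∈ G.edgeSet ↔ e ∈ G'.edgeSet) :
    explore x k G' = explore x k G := by
  have h1 : (explore x k G').1 = (explore x k G).1 := by
    funext i
    refine bfs_congr fun u hu v ↦ h s(u, v) fun hfree ↦ ?_
    exact notMem_oball_of_mem_freePairs hfree hu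
  refine Prod.ext h1 ?_
  have h2 : (explore x k G').2 = G'.deleteEdges (freePairs (explore x k G').1) := rfl
  rw [h2, h1]
  ext u v
  simp only [explore, SimpleGraph.deleteEdges_adj]
  constructor
  · rintro ⟨hadj, hf⟩
    exact ⟨(h s(u, v) hf).2 hadj, hf⟩
  · rintro ⟨hadj, hf⟩
    exact ⟨(h s(u, v) hf).1 hadj, hf⟩

lemma explore_edist_le_iff (x : ι → V) (k : ℕ) (G : SimpleGraph V) (i : ι) (v : V) :
    G.edist (x i) v ≤ k ↔ (explore x k G).2.edist (x i) v ≤ k := by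
  refine SimpleGraph.edist_le_congr (fun u v hu ↦ ?_) le_rfl v
  simp only [explore, SimpleGraph.deleteEdges_adj]
  refine ⟨fun hadj ↦ ⟨hadj, fun hf ↦ ?_⟩, fun h ↦ h.1⟩
  exact notMem_oball_of_mem_freePairs (x := x) (G := G) hf (mem_oball.2 hu)

lemma card_crossPairs {V ι : Type*} (β : ι → Finset V × Finset V) {q : ι × ι} (hq : q.1 ≠ q.2) :
    (crossPairs β q).card = (privateSphere β q.1).card * (privateSphere β q.2).card := by
  classical
  rw [crossPairs, Finset.card_image_of_injOn, Finset.card_product]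
  rintro ⟨a, b⟩ hab ⟨a', b'⟩ hab' h
  simp only [Finset.coe_product, Set.mem_prod, Finset.mem_coe] at hab hab'
  rcases Sym2.eq_iff.1 h with ⟨rfl, rfl⟩ | ⟨rfl, rfl⟩
  · rfl
  · exact absurd (eq_of_mem_privateSphere hab.1 (mem_privateSphere.1 hab'.2).1.1).symm hq

lemma not_isDiag_of_mem_crossPairs {V ι : Type*} {β : ι → Finset V × Finset V} {q : ι × ι}
    (hq : q.1 ≠ q.2) {e : Sym2 V} (he : e ∈ crossPairs β q) : ¬ e.IsDiag := by
  obtain ⟨a, ha, b, hb, rfl⟩ := mem_crossPairs.1 he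
  rw [Sym2.mk_isDiag_iff]
  rintro rfl
  exact hq (eq_of_mem_privateSphere hb (mem_privateSphere.1 ha).1.1)

lemma crossPairs_disjoint {V ι : Type*} [LinearOrder ι] {β : ι → Finset V × Finset V} {q r : ι × ι}
    (hq : q.1 < q.2) (hr : r.1 < r.2) (hqr : q ≠ r) :
    Disjoint (crossPairs β q : Set (Sym2 V)) (crossPairs β r) := by
  rw [Set.disjoint_left]
  intro e he he'
  obtain ⟨a, ha, b, hb, rfl⟩ := mem_crossPairs.1 he
  obtain ⟨a', ha', b', hb', h⟩ := mem_crossPairs.1 he'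
  have h0 : ∀ {i j : ι} {c : V}, c ∈ privateSphere β i → c ∈ privateSphere β j → i = j :=
    fun hi hj ↦ eq_of_mem_privateSphere hj (mem_privateSphere.1 hi).1.1
  rcases Sym2.eq_iff.1 h with ⟨rfl, rfl⟩ | ⟨rfl, rfl⟩
  · exact hqr (Prod.ext (h0 ha ha') (h0 hb hb'))
  · have e1 := h0 ha hb'
    have e2 := h0 hb ha'
    rw [e1, e2] at hq
    exact absurd hq hr.asymm

/-- A single open pair: neither outcome is more likely than `exp (-p lo ^ 2)`. -/
lemma expect_cross_le {lo hi : ℝ} (hlo : 0 ≤ lo) (hhi : (p : ℝ) * hi ^ 2 ≤ 1 / 2)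
    {β : ι → Finset V × Finset V} {q : ι × ι} (hq : q.1 ≠ q.2)
    (h1 : ((privateSphere β q.1).card : ℝ) ∈ Set.Icc lo hi)
    (h2 : ((privateSphere β q.2).card : ℝ) ∈ Set.Icc lo hi) (b : Prop) :
    expect p (fun G ↦ ind ((∃ e ∈ crossPairs β q, e ∈ G.edgeSet) ↔ b)) ≤
      Real.exp (-(p * lo ^ 2)) := by
  have hp0 : (0 : ℝ) ≤ p := p.2.1
  have hp1 : (p : ℝ) ≤ 1 := p.2.2
  have hm : ((crossPairs β q).card : ℝ) =
      (privateSphere β q.1).card * (privateSphere β q.2).card := by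
    exact_mod_cast card_crossPairs β hq
  have hm1 : lo ^ 2 ≤ (crossPairs β q).card := by
    rw [hm, sq]
    exact mul_le_mul h1.1 h2.1 hlo (hlo.trans h1.1)
  have hm2 : ((crossPairs β q).card : ℝ) ≤ hi ^ 2 := by
    rw [hm, sq]
    exact mul_le_mul h1.2 h2.2 (hlo.trans h2.1) (hlo.trans (h1.1.trans h1.2))
  by_cases hb : b
  · simp only [hb, iff_true]
    rw [expect_exists_edge _ fun e he ↦ not_isDiag_of_mem_crossPairs hq he]
    have e1 := one_add_mul_le_pow (a := -(p : ℝ)) (by linarith) (crossPairs β q).card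
    rw [← sub_eq_add_neg] at e1
    have e2 := Real.add_one_le_exp (-((p : ℝ) * lo ^ 2))
    have e3 := mul_le_mul_of_nonneg_left hm2 hp0
    have e4 := mul_le_mul_of_nonneg_left hm1 hp0
    linarith
  · have : ∀ G : SimpleGraph V, ((∃ e ∈ crossPairs β q, e ∈ G.edgeSet) ↔ b) ↔
        ∀ e ∈ crossPairs β q, e ∉ G.edgeSet := by
      intro G
      simp only [hb, iff_false, not_exists, not_and]
    simp only [this]
    rw [expect_no_edge _ fun e he ↦ not_isDiag_of_mem_crossPairs hq he]
    calc (1 - (p : ℝ)) ^ (crossPairs β q).card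
        ≤ Real.exp (-p) ^ (crossPairs β q).card :=
          pow_le_pow_left₀ (by linarith) (Real.one_sub_le_exp_neg _) _
      _ = Real.exp (-(p * (crossPairs β q).card)) := by rw [← Real.exp_nat_mul]; ring_nf
      _ ≤ _ := Real.exp_le_exp.2 (by nlinarith)

variable [Fintype ι] [LinearOrder ι]

open scoped Classical in
/-- The pairs `i < j` for which whether `x i` and `x j` are at distance at most `2 k + 1` is still
open after the exploration, the private spheres having sizes between `lo` and `hi`. -/
noncomputable def openPairs (x : ι → V) (k : ℕ) (lo hi : ℝ)
    (κ : (ι → Finset V × Finset V) × SimpleGraph V) : Finset (ι × ι) :=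
  {q | q.1 < q.2 ∧ ((privateSphere κ.1 q.1).card : ℝ) ∈ Set.Icc lo hi ∧
    ((privateSphere κ.1 q.2).card : ℝ) ∈ Set.Icc lo hi ∧
    ¬ κ.2.edist (x q.1) (x q.2) ≤ (2 * k + 1 : ℕ)}

lemma edist_le_iff_of_mem_openPairs {x : ι → V} {k : ℕ} {lo hi : ℝ} {G : SimpleGraph V} {q : ι × ι}
    (hq : q ∈ openPairs x k lo hi (explore x k G)) :
    G.edist (x q.1) (x q.2) ≤ (2 * k + 1 : ℕ) ↔
      ∃ e ∈ crossPairs (explore x k G).1 q, e ∈ G.edgeSet := by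
  simp only [openPairs, Finset.mem_filter, Finset.mem_univ, true_and] at hq
  obtain ⟨-, -, -, hfar⟩ := hq
  constructor
  · intro h
    rw [two_mul] at h
    obtain ⟨a, b, ha, hb, hab⟩ := SimpleGraph.exists_of_edist_le h
    have ha' := (explore_edist_le_iff x k G q.1 a).1 ha
    have hb' := (explore_edist_le_iff x k G q.2 b).1 hb
    have hclose : ∀ c : ℕ∞, (explore x k G).2.edist a b ≤ c → c ≤ 1 → False := by
      intro c hc hc1
      apply hfar
      refine (SimpleGraph.edist_triangle (v := a)).trans
        ((add_le_add ha' (SimpleGraph.edist_triangle (v := b))).trans ?_)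
      rw [SimpleGraph.edist_comm (u := b)]
      refine (add_le_add le_rfl (add_le_add (hc.trans hc1) hb')).trans ?_
      norm_cast
      omega
    rcases hab with rfl | hadj
    · exact (hclose 0 (by simp) zero_le_one).elim
    · by_cases hf : s(a, b) ∈ freePairs (explore x k G).1
      · refine ⟨s(a, b), ?_, hadj⟩
        obtain ⟨q', -, hq'⟩ := hf
        obtain ⟨a', ha1, b', hb1, he⟩ := mem_crossPairs.1 hq'
        have haB : a ∈ ((explore x k G).1 q.1).2 := mem_cball.2 ha
        have hbB : b ∈ ((explore x k G).1 q.2).2 := mem_cball.2 hb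
        rcases Sym2.eq_iff.1 he with ⟨rfl, rfl⟩ | ⟨rfl, rfl⟩
        · rw [mem_crossPairs]
          rw [← eq_of_mem_privateSphere ha1 haB] at ha1
          rw [← eq_of_mem_privateSphere hb1 hbB] at hb1
          exact ⟨a', ha1, b', hb1, rfl⟩
        · rw [mem_crossPairs]
          rw [← eq_of_mem_privateSphere ha1 hbB] at ha1
          rw [← eq_of_mem_privateSphere hb1 haB] at hb1
          exact ⟨b', hb1, a', ha1, rfl⟩
      · refine (hclose 1 (le_of_eq ?_) le_rfl).elim
        rw [SimpleGraph.edist_eq_one_iff_adj]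
        exact SimpleGraph.deleteEdges_adj.2 ⟨hadj, hf⟩
  · rintro ⟨e, he, he'⟩
    obtain ⟨a, ha, b, hb, rfl⟩ := mem_crossPairs.1 he
    have ha' : G.edist (x q.1) a ≤ k := mem_cball.1 (mem_privateSphere.1 ha).1.1
    have hb' : G.edist (x q.2) b ≤ k := mem_cball.1 (mem_privateSphere.1 hb).1.1
    refine (SimpleGraph.edist_triangle (v := a)).trans
        ((add_le_add ha' (SimpleGraph.edist_triangle (v := b))).trans ?_)
    rw [SimpleGraph.edist_comm (u := b)]
    refine (add_le_add le_rfl (add_le_add (SimpleGraph.edist_eq_one_iff_adj.2 he').le hb')).trans ?_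
    norm_cast
    omega

/-- Any prescribed outcome for which pairs `x i`, `x j` are at distance at most `2 k + 1` is
exponentially unlikely in the number of open pairs. -/
lemma expect_outcome_le (x : ι → V) (k : ℕ) {lo hi : ℝ} (hlo : 0 ≤ lo)
    (hhi : (p : ℝ) * hi ^ 2 ≤ 1 / 2) (N : ℝ) (b : ι × ι → Prop) :
    expect p (fun G ↦ ind (N ≤ (openPairs x k lo hi (explore x k G)).card ∧
      ∀ q : ι × ι, G.edist (x q.1) (x q.2) ≤ (2 * k + 1 : ℕ) ↔ b q)) ≤
      Real.exp (-(p * lo ^ 2 * N)) := by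
  classical
  have e1 : ∀ G : SimpleGraph V, ind (N ≤ (openPairs x k lo hi (explore x k G)).card ∧
      ∀ q : ι × ι, G.edist (x q.1) (x q.2) ≤ (2 * k + 1 : ℕ) ↔ b q) ≤
      ind (N ≤ (openPairs x k lo hi (explore x k G)).card) *
        ∏ q ∈ openPairs x k lo hi (explore x k G),
          ind ((∃ e ∈ crossPairs (explore x k G).1 q, e ∈ G.edgeSet) ↔ b q) := by
    intro G
    rw [ind_and]
    refine mul_le_mul_of_nonneg_left ?_ (ind_nonneg _)
    by_cases h : ∀ q : ι × ι, G.edist (x q.1) (x q.2) ≤ (2 * k + 1 : ℕ) ↔ b q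
    · rw [ind_true h, Finset.prod_eq_one]
      intro q hq
      exact ind_true ((edist_le_iff_of_mem_openPairs hq).symm.trans (h q))
    · rw [ind_false h]
      exact Finset.prod_nonneg fun q _ ↦ ind_nonneg _
  refine (expect_mono e1).trans ?_
  have hmem : ∀ {κ : (ι → Finset V × Finset V) × SimpleGraph V} {q : ι × ι},
      q ∈ openPairs x k lo hi κ → q.1 < q.2 ∧
        ((privateSphere κ.1 q.1).card : ℝ) ∈ Set.Icc lo hi ∧
        ((privateSphere κ.1 q.2).card : ℝ) ∈ Set.Icc lo hi := by
    intro κ q hq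
    simp only [openPairs, Finset.mem_filter, Finset.mem_univ, true_and] at hq
    exact ⟨hq.1, hq.2.1, hq.2.2.1⟩
  have hdet : ∀ (β : ι → Finset V × Finset V) (q : ι × ι), EdgeDetermined (fun G : SimpleGraph V ↦
      ind ((∃ e ∈ crossPairs β q, e ∈ G.edgeSet) ↔ b q)) (crossPairs β q) := by
    intro β q G G' h
    have : (∃ e ∈ crossPairs β q, e ∈ G.edgeSet) ↔ ∃ e ∈ crossPairs β q, e ∈ G'.edgeSet :=
      exists_congr fun e ↦ and_congr_right fun he ↦ h e he
    simp only [this]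
  rw [expect_deferred (explore x k) (fun κ ↦ (freePairs κ.1)ᶜ) (explore_stopping x k)
    (fun κ ↦ ind (N ≤ (openPairs x k lo hi κ).card))
    (fun κ G ↦ ∏ q ∈ openPairs x k lo hi κ,
          ind ((∃ e ∈ crossPairs κ.1 q, e ∈ G.edgeSet) ↔ b q))]
  · rw [← expect_const (V := V) (p := p) (Real.exp _)]
    refine expect_mono fun G ↦ ?_
    set κ := explore x k G
    rw [expect_prod_of_disjoint _ (J := fun q ↦ crossPairs κ.1 q) (fun q _ ↦ hdet κ.1 q)
      fun q hq r hr hqr ↦ crossPairs_disjoint (hmem hq).1 (hmem hr).1 hqr]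
    by_cases hN : N ≤ (openPairs x k lo hi κ).card
    · rw [ind_true hN, one_mul]
      calc _ ≤ ∏ q ∈ openPairs x k lo hi κ, Real.exp (-(p * lo ^ 2)) :=
            Finset.prod_le_prod (fun q _ ↦ expect_nonneg fun G ↦ ind_nonneg _) fun q hq ↦
              expect_cross_le hlo hhi (hmem hq).1.ne (hmem hq).2.1 (hmem hq).2.2 (b q)
        _ = Real.exp (-(p * lo ^ 2 * (openPairs x k lo hi κ).card)) := by
            rw [Finset.prod_const, ← Real.exp_nat_mul]; ring_nf
        _ ≤ _ := Real.exp_le_exp.2 (neg_le_neg (mul_le_mul_of_nonneg_left hN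
            (mul_nonneg p.2.1 (sq_nonneg _))))
    · rw [ind_false hN, zero_mul]
      exact (Real.exp_pos _).le
  · intro G G₁ G₂ hG
    refine Finset.prod_congr rfl fun q hq ↦ hdet _ q G₁ G₂ fun e he ↦ hG e ?_
    rw [compl_compl]
    exact ⟨q, (hmem hq).1.ne, he⟩

/-- A family of `|F|` distance matrices contains the one of the vertices `x i` only with small
probability. -/
lemma expect_exists_matrix_le {τ : Type*} (F : Finset τ) (M : τ → ι → ι → ℕ∞) (x : ι → V) (k : ℕ)
    {lo hi : ℝ} (hlo : 0 ≤ lo) (hhi : (p : ℝ) * hi ^ 2 ≤ 1 / 2) (N : ℝ) :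
    expect p (fun G ↦ ind (∃ t ∈ F, ∀ i j, M t i j = G.edist (x i) (x j))) ≤
      expect p (fun G ↦ ind (((openPairs x k lo hi (explore x k G)).card : ℝ) < N)) +
        F.card * Real.exp (-(p * lo ^ 2 * N)) := by
  have h1 : ∀ G : SimpleGraph V, ind (∃ t ∈ F, ∀ i j, M t i j = G.edist (x i) (x j)) ≤
      ind (((openPairs x k lo hi (explore x k G)).card : ℝ) < N) +
        ∑ t ∈ F, ind (N ≤ (openPairs x k lo hi (explore x k G)).card ∧
          ∀ q : ι × ι, G.edist (x q.1) (x q.2) ≤ (2 * k + 1 : ℕ) ↔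
            M t q.1 q.2 ≤ (2 * k + 1 : ℕ)) := by
    intro G
    have hs : 0 ≤ ∑ t ∈ F, ind (N ≤ (openPairs x k lo hi (explore x k G)).card ∧
          ∀ q : ι × ι, G.edist (x q.1) (x q.2) ≤ (2 * k + 1 : ℕ) ↔
            M t q.1 q.2 ≤ (2 * k + 1 : ℕ)) := Finset.sum_nonneg fun t _ ↦ ind_nonneg _
    by_cases hN : ((openPairs x k lo hi (explore x k G)).card : ℝ) < N
    · rw [ind_true hN]
      exact (ind_le_one _).trans (le_add_of_nonneg_right hs)
    · rw [ind_false hN, zero_add]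
      by_cases h : ∃ t ∈ F, ∀ i j, M t i j = G.edist (x i) (x j)
      · rw [ind_true h]
        obtain ⟨t, ht, htM⟩ := h
        refine le_trans (le_of_eq ?_) (Finset.single_le_sum (fun t _ ↦ ind_nonneg _) ht)
        rw [ind_true ⟨not_lt.1 hN, fun q ↦ by rw [htM]⟩]
      · rw [ind_false h]; exact hs
  refine (expect_mono h1).trans ?_
  rw [expect_add, expect_sum]
  refine add_le_add le_rfl ?_
  refine (Finset.sum_le_card_nsmul _ _ _ fun t _ ↦ expect_outcome_le x k hlo hhi N _).trans
    (le_of_eq (nsmul_eq_mul _ _))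

end Fibres

/-! ### Most pairs are open -/

section OpenPairs

open MeasureTheory ProbabilityTheory

variable {V : Type*} [Fintype V] {p : I} {s : ℕ}

/-- The number of vertices, counted with multiplicity, that the ball around `x i` shares with other
balls. -/
noncomputable def overlap (x : Fin s → V) (k : ℕ) (i : Fin s) (G : SimpleGraph V) : ℝ :=
  ∑ j ∈ Finset.univ.erase i, ∑ a, ind (x i ∈ cball G a k) * ind (x j ∈ cball G a k)

lemma overlap_nonneg (x : Fin s → V) (k : ℕ) (i : Fin s) (G : SimpleGraph V) :
    0 ≤ overlap x k i G :=
  Finset.sum_nonneg fun _ _ ↦ Finset.sum_nonneg fun _ _ ↦ mul_nonneg (ind_nonneg _) (ind_nonneg _)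

lemma expect_overlap_le {x : Fin s → V} (hx : Function.Injective x) (k : ℕ) (i : Fin s) :
    expect p (overlap x k i) ≤ s * (5 * growth V p ^ (2 * k) / Fintype.card V) := by
  classical
  have hD := one_le_growth (V := V) (p := p)
  have hn : (0 : ℝ) < Fintype.card V := by
    exact_mod_cast Fintype.card_pos_iff.2 ⟨x i⟩
  have hpow : growth V p ^ k ≤ growth V p ^ (2 * k) := pow_le_pow_right₀ hD (by omega)
  have h1 : ∀ j ∈ Finset.univ.erase i, expect p (fun G ↦ ∑ a, ind (x i ∈ cball G a k) *
      ind (x j ∈ cball G a k)) ≤ 5 * growth V p ^ (2 * k) / Fintype.card V := by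
    intro j hj
    have hij : x i ≠ x j := fun h ↦ Finset.ne_of_mem_erase hj (hx h).symm
    have h2 : ∀ a : V, expect p (fun G ↦ ind (x i ∈ cball G a k) * ind (x j ∈ cball G a k)) ≤
        (if a = x i then growth V p ^ (2 * k) / Fintype.card V else 0) +
        (if a = x j then growth V p ^ (2 * k) / Fintype.card V else 0) +
          3 * growth V p ^ (2 * k) / Fintype.card V ^ 2 := by
      intro a
      have h0 : 0 ≤ growth V p ^ (2 * k) / Fintype.card V := by positivity
      have h3 : 0 ≤ 3 * growth V p ^ (2 * k) / (Fintype.card V : ℝ) ^ 2 := by positivity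
      have hdiv : growth V p ^ k / Fintype.card V ≤ growth V p ^ (2 * k) / Fintype.card V := by
        gcongr
      by_cases hi : a = x i
      · subst hi
        have e1 : expect p (fun G ↦ ind (x i ∈ cball G (x i) k) * ind (x j ∈ cball G (x i) k)) ≤
            expect p (fun G ↦ ind (x j ∈ cball G (x i) k)) :=
          expect_mono fun G ↦ mul_le_of_le_one_left (ind_nonneg _) (ind_le_one _)
        have e2 := expect_mem_cball_le (p := p) hij.symm k
        rw [if_pos rfl, if_neg hij]
        linarith
      · by_cases hj : a = x j
        · subst hj
          have e1 : expect p (fun G ↦ ind (x i ∈ cball G (x j) k) * ind (x j ∈ cball G (x j) k)) ≤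
              expect p (fun G ↦ ind (x i ∈ cball G (x j) k)) :=
            expect_mono fun G ↦ mul_le_of_le_one_right (ind_nonneg _) (ind_le_one _)
          have e2 := expect_mem_cball_le (p := p) hij k
          rw [if_pos rfl, if_neg hi]
          linarith
        · rw [if_neg hi, if_neg hj]
          have := expect_mem_mul_mem_le (p := p) (Ne.symm hi) (Ne.symm hj) hij k
          linarith
    rw [expect_sum]
    refine (Finset.sum_le_sum fun a _ ↦ h2 a).trans (le_of_eq ?_)
    simp only [Finset.sum_add_distrib, Finset.sum_ite_eq', Finset.mem_univ, if_true,
      Finset.sum_const, Finset.card_univ, nsmul_eq_mul]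
    field_simp
    ring
  unfold overlap
  rw [expect_sum]
  refine (Finset.sum_le_card_nsmul _ _ _ h1).trans ?_
  rw [nsmul_eq_mul]
  refine mul_le_mul_of_nonneg_right ?_ (by positivity)
  exact_mod_cast (Finset.card_le_univ _).trans (by simp)

lemma card_privateSphere_le (x : Fin s → V) (k : ℕ) (i : Fin s) (G : SimpleGraph V) :
    ((privateSphere (explore x k G).1 i).card : ℝ) ≤ sphereCard (x i) k G := by
  classical
  refine Nat.cast_le.2 (Finset.card_le_card fun a ha ↦ ?_)
  exact Finset.mem_sdiff.2 (mem_privateSphere.1 ha).1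

/-- A vertex of the sphere that is not private is counted by the overlap. -/
lemma sphereCard_le_card_privateSphere_add (x : Fin s → V) (k : ℕ) (i : Fin s) (G : SimpleGraph V) :
    sphereCard (x i) k G ≤ (privateSphere (explore x k G).1 i).card + overlap x k i G := by
  classical
  have h0 : ∀ j a, 0 ≤ ind (x i ∈ cball G a k) * ind (x j ∈ cball G a k) :=
    fun j a ↦ mul_nonneg (ind_nonneg _) (ind_nonneg _)
  rw [sphereCard, overlap, Finset.sum_comm, ← sum_ind, ← sum_ind, ← Finset.sum_add_distrib]
  refine Finset.sum_le_sum fun a _ ↦ ?_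
  have h1 := Finset.sum_nonneg fun j (_ : j ∈ Finset.univ.erase i) ↦ h0 j a
  by_cases ha : a ∈ (bfs (x i) k G).2 \ (bfs (x i) k G).1
  · rw [ind_true ha]
    by_cases hp : a ∈ privateSphere (explore x k G).1 i
    · rw [ind_true hp]
      linarith
    · rw [mem_privateSphere] at hp
      push Not at hp
      obtain ⟨j, hj, haj⟩ := hp (Finset.mem_sdiff.1 ha)
      have hai := (Finset.mem_sdiff.1 ha).1
      have e1 : x i ∈ cball G a k := by
        rw [mem_cball, SimpleGraph.edist_comm]; exact mem_cball.1 hai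
      have e2 : x j ∈ cball G a k := by
        rw [mem_cball, SimpleGraph.edist_comm]; exact mem_cball.1 haj
      have e3 := Finset.single_le_sum (fun j _ ↦ h0 j a)
        (Finset.mem_erase.2 ⟨hj, Finset.mem_univ j⟩)
      rw [ind_true e2, mul_one] at e3
      nth_rewrite 1 [ind_true e1] at e3
      have e4 := ind_nonneg (a ∈ privateSphere (explore x k G).1 i)
      linarith
  · rw [ind_false ha]
    exact add_nonneg (ind_nonneg _) h1

/-- The numerical conditions under which the exploration of `s` balls of radius `k` in `G(V, p)`
behaves as expected, up to a small error `η`: the radius `k` is so small that pairs of vertices at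
distance at most `2 k + 1` are rare and that `s` balls of radius `k` hardly overlap. -/
structure Sparse (V : Type*) [Fintype V] (p : I) (s k : ℕ) (η : ℝ) : Prop where
  one_le : 1 ≤ growth V p - 1
  le_one : η ≤ 1
  pow_le : growth V p ^ (2 * k) ≤ (1 + η) * (growth V p - 1) ^ (2 * k)
  inv_le : 1 / growth V p ≤ η
  radius_le : k * (2 * growth V p ^ (2 * k + 1) / Fintype.card V) ≤ η
  close_le : growth V p ^ (2 * k + 1) / Fintype.card V ≤ η
  overlap_le : s * (growth V p ^ (2 * k) / Fintype.card V) ≤ η * (growth V p - 1) ^ k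

lemma Sparse.nonneg {k : ℕ} {η : ℝ} (h : Sparse V p s k η) : 0 ≤ η := by
  have := one_le_growth (V := V) (p := p)
  exact (by positivity : 0 ≤ 1 / growth V p).trans h.inv_le

lemma expect_privateSphere_bad_le {k : ℕ} {η : ℝ} (h : Sparse V p s k η) {x : Fin s → V}
    (hx : Function.Injective x) (i : Fin s) :
    expect p (fun G ↦ ind (((privateSphere (explore x k G).1 i).card : ℝ) ∉
      Set.Icc ((growth V p - 1) ^ k / 4) (3 / 2 * (growth V p - 1) ^ k))) ≤ 40 * η := by
  have hd0 : 0 < (growth V p - 1) ^ k := pow_pos (zero_lt_one.trans_le h.one_le) k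
  have h1 : ∀ G : SimpleGraph V, ind (((privateSphere (explore x k G).1 i).card : ℝ) ∉
      Set.Icc ((growth V p - 1) ^ k / 4) (3 / 2 * (growth V p - 1) ^ k)) ≤
      ind ((growth V p - 1) ^ k / 2 ≤ |sphereCard (x i) k G - (growth V p - 1) ^ k|) +
      ind ((growth V p - 1) ^ k / 4 ≤ overlap x k i G) := by
    intro G
    have e1 := card_privateSphere_le x k i G
    have e2 := sphereCard_le_card_privateSphere_add x k i G
    have n1 := ind_nonneg ((growth V p - 1) ^ k / 2 ≤
      |sphereCard (x i) k G - (growth V p - 1) ^ k|)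
    have n2 := ind_nonneg ((growth V p - 1) ^ k / 4 ≤ overlap x k i G)
    by_cases hA : (growth V p - 1) ^ k / 2 ≤ |sphereCard (x i) k G - (growth V p - 1) ^ k|
    · rw [ind_true hA]
      linarith [ind_le_one (((privateSphere (explore x k G).1 i).card : ℝ) ∉
        Set.Icc ((growth V p - 1) ^ k / 4) (3 / 2 * (growth V p - 1) ^ k))]
    by_cases hB : (growth V p - 1) ^ k / 4 ≤ overlap x k i G
    · rw [ind_true hB]
      linarith [ind_le_one (((privateSphere (explore x k G).1 i).card : ℝ) ∉
        Set.Icc ((growth V p - 1) ^ k / 4) (3 / 2 * (growth V p - 1) ^ k))]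
    rw [ind_false (P := _ ∉ _)]
    · linarith
    · push Not at hA hB ⊢
      rw [abs_lt] at hA
      exact ⟨by linarith, by linarith⟩
  refine (expect_mono h1).trans ?_
  rw [expect_add]
  have h2 := expect_sphereCard_far_le (p := p) (x i) h.one_le h.le_one h.pow_le h.inv_le h.radius_le
  have h3 := expect_ind_le_div (p := p) (overlap_nonneg x k i)
    (by positivity : 0 < (growth V p - 1) ^ k / 4)
  have h4 : expect p (overlap x k i) / ((growth V p - 1) ^ k / 4) ≤ 20 * η := by
    rw [div_le_iff₀ (by positivity)]
    refine (expect_overlap_le hx k i).trans ?_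
    have := h.overlap_le
    have e : (s : ℝ) * (5 * growth V p ^ (2 * k) / Fintype.card V) =
      5 * (s * (growth V p ^ (2 * k) / Fintype.card V)) := by ring
    rw [e]
    linarith
  linarith

lemma sum_ind_lt (s : ℕ) : ∑ q : Fin s × Fin s, ind (q.1 < q.2) = (s * s - s : ℝ) / 2 := by
  rw [Fintype.sum_prod_type]
  have h1 : ∀ i j : Fin s, ind (i < j) + ind (j < i) + ind (j ∈ ({i} : Finset (Fin s))) = 1 := by
    intro i j
    rcases lt_trichotomy i j with h | h | h
    · simp [ind, h, h.asymm, h.ne']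
    · simp [ind, h]
    · simp [ind, h, h.asymm, h.ne]
  have h2 : ∑ i : Fin s, ∑ j : Fin s,
      (ind (i < j) + ind (j < i) + ind (j ∈ ({i} : Finset (Fin s)))) = (s * s : ℝ) := by
    simp only [h1]
    simp
  simp only [Finset.sum_add_distrib, sum_ind, Finset.card_singleton] at h2
  rw [Finset.sum_comm (f := fun i j : Fin s ↦ ind (j < i))] at h2
  simp only [Nat.cast_one, Finset.sum_const, Finset.card_univ, Fintype.card_fin, nsmul_eq_mul,
    mul_one] at h2
  linarith

/-- With high probability a positive fraction of all pairs of roots is open after the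
exploration. -/
lemma expect_few_openPairs_le {k : ℕ} {η : ℝ} (h : Sparse V p s k η) (hs : 2 ≤ s) {x : Fin s → V}
    (hx : Function.Injective x) :
    expect p (fun G ↦ ind (((openPairs x k ((growth V p - 1) ^ k / 4)
      (3 / 2 * (growth V p - 1) ^ k) (explore x k G)).card : ℝ) < s ^ 2 / 8)) ≤ 324 * η := by
  classical
  set lo := (growth V p - 1) ^ k / 4
  set hi := 3 / 2 * (growth V p - 1) ^ k
  have hs' : (2 : ℝ) ≤ s := by exact_mod_cast hs
  have hη := h.nonneg
  set bad : Fin s → SimpleGraph V → ℝ := fun i G ↦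
    ind (((privateSphere (explore x k G).1 i).card : ℝ) ∉ Set.Icc lo hi)
  set X : SimpleGraph V → ℝ := fun G ↦ ∑ q : Fin s × Fin s, ind (q.1 < q.2) *
    (bad q.1 G + bad q.2 G + ind (x q.2 ∈ cball G (x q.1) (2 * k + 1))) with hX
  have hX0 : ∀ G, 0 ≤ X G := fun G ↦ Finset.sum_nonneg fun q _ ↦ mul_nonneg (ind_nonneg _)
    (add_nonneg (add_nonneg (ind_nonneg _) (ind_nonneg _)) (ind_nonneg _))
  have hEX : expect p X ≤ (s * s - s : ℝ) / 2 * (81 * η) := by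
    rw [hX, expect_sum, ← sum_ind_lt, Finset.sum_mul]
    refine Finset.sum_le_sum fun q _ ↦ ?_
    rw [expect_mul_left]
    by_cases hq : q.1 < q.2
    · refine mul_le_mul_of_nonneg_left ?_ (ind_nonneg _)
      rw [expect_add, expect_add]
      have e1 := expect_privateSphere_bad_le h hx q.1
      have e2 := expect_privateSphere_bad_le h hx q.2
      have e3 := (expect_mem_cball_le (p := p) (hx.ne hq.ne') (2 * k + 1)).trans h.close_le
      linarith
    · simp [ind_false hq]
  have hopen : ∀ G, (s * s - s : ℝ) / 2 - X G ≤ (openPairs x k lo hi (explore x k G)).card := by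
    intro G
    rw [hX, ← sum_ind_lt, ← sum_ind, ← Finset.sum_sub_distrib]
    refine Finset.sum_le_sum fun q _ ↦ ?_
    have n1 : 0 ≤ bad q.1 G := ind_nonneg _
    have n2 : 0 ≤ bad q.2 G := ind_nonneg _
    have n3 := ind_nonneg (x q.2 ∈ cball G (x q.1) (2 * k + 1))
    have n4 := ind_nonneg (q ∈ openPairs x k lo hi (explore x k G))
    by_cases hq : q.1 < q.2
    · rw [ind_true hq, one_mul]
      by_cases h1 : ((privateSphere (explore x k G).1 q.1).card : ℝ) ∈ Set.Icc lo hi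
      · by_cases h2 : ((privateSphere (explore x k G).1 q.2).card : ℝ) ∈ Set.Icc lo hi
        · by_cases h3 : x q.2 ∈ cball G (x q.1) (2 * k + 1)
          · rw [ind_true h3]
            linarith
          · rw [ind_true (P := q ∈ _)]
            · linarith
            · simp only [openPairs, Finset.mem_filter, Finset.mem_univ, true_and]
              refine ⟨hq, h1, h2, fun hle ↦ h3 (mem_cball.2 (le_trans ?_ hle))⟩
              exact SimpleGraph.edist_anti (SimpleGraph.deleteEdges_le _)
        · have : bad q.2 G = 1 := ind_true h2
          linarith
      · have : bad q.1 G = 1 := ind_true h1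
        linarith
    · rw [ind_false hq]
      linarith
  have h1 : ∀ G, ind (((openPairs x k lo hi (explore x k G)).card : ℝ) < s ^ 2 / 8) ≤
      ind ((s : ℝ) ^ 2 / 8 ≤ X G) := fun G ↦ ind_mono fun hlt ↦ by
    nlinarith [hopen G]
  refine (expect_mono h1).trans ((expect_ind_le_div hX0 (by positivity)).trans ?_)
  rw [div_le_iff₀ (by positivity)]
  nlinarith

end OpenPairs

/-! ### Counting short labelings -/

section Labels

open MeasureTheory ProbabilityTheory

/-- There are at most `(B + 1) ^ s * (|α| + 1) ^ B` families of `s` words over `α` of total length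
at most `B`: such a family is determined by the lengths of its words and by their concatenation. -/
lemma exists_finset_words (α : Type*) [Fintype α] (s B : ℕ) :
    ∃ F : Finset (Fin s → List α), (∀ L, ∑ i, (L i).length ≤ B → L ∈ F) ∧
      F.card ≤ (B + 1) ^ s * (Fintype.card α + 1) ^ B := by
  classical
  set f : {L : Fin s → List α // ∑ i, (L i).length ≤ B} →
      (Fin s → Fin (B + 1)) × (Fin B → Option α) := fun L ↦
    (fun i ↦ ⟨(L.1 i).length, Nat.lt_succ_of_le
      ((Finset.single_le_sum (fun j _ ↦ Nat.zero_le (L.1 j).length)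
        (Finset.mem_univ i)).trans L.2)⟩,
      fun t ↦ (List.ofFn L.1).flatten[t.1]?) with hf
  have hlen : ∀ L : Fin s → List α, (List.ofFn L).flatten.length = ∑ i, (L i).length := by
    intro L
    rw [List.length_flatten, List.map_ofFn, List.sum_ofFn]
    rfl
  have hinj : Function.Injective f := by
    rintro ⟨L, hL⟩ ⟨L', hL'⟩ h
    have h1 : ∀ i, (L i).length = (L' i).length := fun i ↦
      congrArg Fin.val (congrFun (congrArg Prod.fst h) i)
    have h2 : ∀ t : Fin B, (List.ofFn L).flatten[t.1]? = (List.ofFn L').flatten[t.1]? :=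
      fun t ↦ congrFun (congrArg Prod.snd h) t
    apply Subtype.ext
    apply List.ofFn_injective
    rw [List.eq_iff_flatten_eq]
    constructor
    · refine List.ext_getElem? fun t ↦ ?_
      by_cases ht : t < B
      · exact h2 ⟨t, ht⟩
      · rw [List.getElem?_eq_none, List.getElem?_eq_none]
        · rw [hlen]; exact hL'.trans (not_lt.1 ht)
        · rw [hlen]; exact hL.trans (not_lt.1 ht)
    · rw [List.map_ofFn, List.map_ofFn]
      congr 1
      funext i
      exact h1 i
  have hfin : Finite {L : Fin s → List α // ∑ i, (L i).length ≤ B} := Finite.of_injective f hinj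
  have hfin' : {L : Fin s → List α | ∑ i, (L i).length ≤ B}.Finite := hfin
  refine ⟨hfin'.toFinset, fun L hL ↦ by simpa using hL, ?_⟩
  have h1 := Nat.card_le_card_of_injective f hinj
  rw [Nat.card_prod, Nat.card_fun, Nat.card_fun] at h1
  rw [Nat.card_eq_fintype_card (α := Fin (B + 1)), Nat.card_eq_fintype_card (α := Fin s),
    Nat.card_eq_fintype_card (α := Option α), Nat.card_eq_fintype_card (α := Fin B),
    Fintype.card_fin, Fintype.card_fin, Fintype.card_fin, Fintype.card_option] at h1
  refine le_trans (le_of_eq ?_) h1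
  rw [← Set.ncard_eq_toFinset_card _ hfin']
  rfl

variable {V : Type*} [Fintype V] {p : I}

/-- Short labelings rarely recover all distances. If a labeling is short, then half of the disjoint
blocks `x b` have short labels, and each block is covered by the bound for a fixed family of
distance matrices. -/
lemma expect_short_labeling_le {α : Type*} [Fintype α] (Q : V → V → List α → List α → ℕ∞)
    {m s k : ℕ} (hm : 0 < m) (hs : 2 ≤ s) {x : Fin m → Fin s → V}
    (hx : Function.Injective fun bi : Fin m × Fin s ↦ x bi.1 bi.2) {η T : ℝ} {B : ℕ}
    (hB : 2 * T ≤ m * (B + 1)) (h : Sparse V p s k η)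
    (hhi : (p : ℝ) * (3 / 2 * (growth V p - 1) ^ k) ^ 2 ≤ 1 / 2) :
    expect p (fun G ↦ ind (∃ L : V → List α, (∀ u v, Q u v (L u) (L v) = G.edist u v) ∧
      ((∑ v, (L v).length : ℕ) : ℝ) ≤ T)) ≤
      2 * (324 * η + (B + 1) ^ s * (Fintype.card α + 1) ^ B *
        Real.exp (-(p * ((growth V p - 1) ^ k / 4) ^ 2 * (s ^ 2 / 8)))) := by
  classical
  obtain ⟨F, hF, hFcard⟩ := exists_finset_words α s B
  set R := Real.exp (-(p * ((growth V p - 1) ^ k / 4) ^ 2 * (s ^ 2 / 8)))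
  set M : Fin m → (Fin s → List α) → Fin s → Fin s → ℕ∞ :=
    fun b t i j ↦ Q (x b i) (x b j) (t i) (t j)
  set good : Fin m → SimpleGraph V → Prop := fun b G ↦
    ∃ t ∈ F, ∀ i j, M b t i j = G.edist (x b i) (x b j)
  have hm' : (0 : ℝ) < m := by exact_mod_cast hm
  have hlo : 0 ≤ (growth V p - 1) ^ k / 4 := by
    have := zero_le_one.trans h.one_le
    positivity
  have h1 : ∀ G : SimpleGraph V, ind (∃ L : V → List α,
      (∀ u v, Q u v (L u) (L v) = G.edist u v) ∧ ((∑ v, (L v).length : ℕ) : ℝ) ≤ T) ≤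
      2 / m * ∑ b, ind (good b G) := by
    intro G
    have hnn : 0 ≤ ∑ b, ind (good b G) := Finset.sum_nonneg fun b _ ↦ ind_nonneg _
    by_cases hL : ∃ L : V → List α,
      (∀ u v, Q u v (L u) (L v) = G.edist u v) ∧ ((∑ v, (L v).length : ℕ) : ℝ) ≤ T
    · rw [ind_true hL]
      obtain ⟨L, hQ, hT⟩ := hL
      have e1 : ∑ b, ∑ i, (L (x b i)).length ≤ ∑ v, (L v).length := by
        rw [← Fintype.sum_prod_type' fun b i ↦ (L (x b i)).length,
          ← Finset.sum_image (s := Finset.univ) (f := fun v ↦ (L v).length)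
            (g := fun bi : Fin m × Fin s ↦ x bi.1 bi.2) fun _ _ _ _ h ↦ hx h]
        exact Finset.sum_le_sum_of_subset (Finset.subset_univ _)
      -- a block with long labels contributes at least `B + 1`
      have e2 : ∀ b, (B + 1 : ℝ) * (1 - ind (good b G)) ≤ ((∑ i, (L (x b i)).length : ℕ) : ℝ) := by
        intro b
        by_cases hb : ∑ i, (L (x b i)).length ≤ B
        · rw [ind_true ⟨fun i ↦ L (x b i), hF _ hb, fun i j ↦ hQ _ _⟩]
          simp only [sub_self, mul_zero]
          positivity
        · have h3 : (B : ℝ) + 1 ≤ ((∑ i, (L (x b i)).length : ℕ) : ℝ) := by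
            exact_mod_cast not_le.1 hb
          have h4 := ind_nonneg (good b G)
          nlinarith [(Nat.cast_nonneg B : (0 : ℝ) ≤ B)]
      have e3 := Finset.sum_le_sum fun b (_ : b ∈ Finset.univ) ↦ e2 b
      rw [← Finset.mul_sum, Finset.sum_sub_distrib, ← Nat.cast_sum] at e3
      simp only [Finset.sum_const, Finset.card_univ, Fintype.card_fin, nsmul_eq_mul, mul_one] at e3
      have e4 : (B + 1 : ℝ) * (m - ∑ b, ind (good b G)) ≤ T :=
        e3.trans ((Nat.cast_le.2 e1).trans hT)
      have e5 : (B + 1 : ℝ) * (2 * (m - ∑ b, ind (good b G))) ≤ (B + 1) * m := by linarith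
      have e6 := le_of_mul_le_mul_left e5 (by positivity)
      rw [div_mul_eq_mul_div, le_div_iff₀ hm']
      linarith
    · rw [ind_false hL]
      positivity
  refine (expect_mono h1).trans ?_
  rw [expect_mul_left, expect_sum]
  have h2 : ∀ b ∈ (Finset.univ : Finset (Fin m)), expect p (fun G ↦ ind (good b G)) ≤
      324 * η + (B + 1) ^ s * (Fintype.card α + 1) ^ B * R := by
    intro b _
    have hxb : Function.Injective (x b) := fun i j hij ↦
      congrArg Prod.snd (hx (a₁ := (b, i)) (a₂ := (b, j)) hij)
    refine (expect_exists_matrix_le F (M b) (x b) k hlo hhi ((s : ℝ) ^ 2 / 8)).trans ?_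
    refine add_le_add (expect_few_openPairs_le h hs hxb) ?_
    refine mul_le_mul_of_nonneg_right ?_ (Real.exp_pos _).le
    exact_mod_cast hFcard
  refine (mul_le_mul_of_nonneg_left (Finset.sum_le_card_nsmul _ _ _ h2) (by positivity)).trans
    (le_of_eq ?_)
  rw [nsmul_eq_mul, Finset.card_univ, Fintype.card_fin]
  field_simp

/-- A vertex set with at least `m * s` vertices contains `m` disjoint blocks of `s` vertices. -/
lemma exists_blocks {n m s : ℕ} (h : m * s ≤ n) :
    ∃ x : Fin m → Fin s → Fin n, Function.Injective fun bi : Fin m × Fin s ↦ x bi.1 bi.2 :=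
  ⟨fun b i ↦ Fin.castLE h (finProdFinEquiv (b, i)), fun _ _ hab ↦
    finProdFinEquiv.injective (Fin.castLE_injective h hab)⟩

end Labels

/-! ### The choice of the radius -/

section Asymptotics

open MeasureTheory ProbabilityTheory

lemma growth_edgeProb {n : ℕ} (hn : 0 < n) : growth (Fin n) (edgeProb n) = 1 + 2 * Real.log n := by
  have : (n : ℝ) ≠ 0 := by exact_mod_cast hn.ne'
  simp only [growth, Fintype.card_fin, edgeProb]
  field_simp

lemma nat_sqrt_bounds {n : ℕ} (hn : 0 < n) :
    √(n : ℝ) / 2 ≤ Nat.sqrt n ∧ (Nat.sqrt n : ℝ) ≤ √(n : ℝ) := by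
  refine ⟨?_, Real.nat_sqrt_le_real_sqrt⟩
  have h1 := Real.real_sqrt_lt_nat_sqrt_succ (a := n)
  have h2 : (1 : ℝ) ≤ Nat.sqrt n := by exact_mod_cast Nat.sqrt_pos.2 hn
  linarith

/-- The choice of the radius: `k + 1` is the largest exponent for which `(2 log n) ^ (k + 1)` is at
most `√n`. Then `k` is of smaller order than `log n`, so that `1 + 2 log n` and `2 log n` have
almost the same `2 k`-th power. -/
lemma exists_radius {n : ℕ} {d η : ℝ} (hn : 0 < n) (hd : d = 2 * Real.log n) (hd5 : 5 ≤ d)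
    (hdn : d ≤ √(n : ℝ)) (hη : η ≤ 1) (h1 : 4 / d ≤ η) (h2 : 2 / Real.log d ≤ η)
    (h3 : 1 / (2 * Real.log d) ≤ Real.log (1 + η)) :
    ∃ k : ℕ, Sparse (Fin n) (edgeProb n) (Nat.sqrt n) k η ∧ (n : ℝ) ≤ d ^ (2 * k + 4) ∧
      d ^ (2 * k + 2) ≤ n := by
  have hn0 : (0 : ℝ) < n := by exact_mod_cast hn
  have hd0 : 0 < d := by linarith
  have hld : 0 < Real.log d := Real.log_pos (by linarith)
  have hη0 : 0 < η := lt_of_lt_of_le (by positivity) h1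
  obtain ⟨m, hm1, hm2⟩ := exists_nat_pow_near (x := √(n : ℝ)) (y := d) (by linarith) (by linarith)
  obtain ⟨k, rfl⟩ : ∃ k, m = k + 1 := by
    refine Nat.exists_eq_succ_of_ne_zero ?_
    rintro rfl
    simp only [zero_add, pow_one] at hm2
    linarith
  have hsq : √(n : ℝ) ^ 2 = n := Real.sq_sqrt hn0.le
  have hup : d ^ (2 * k + 2) ≤ n := by
    calc d ^ (2 * k + 2) = (d ^ (k + 1)) ^ 2 := by ring
      _ ≤ √(n : ℝ) ^ 2 := by gcongr
      _ = n := hsq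
  have hlow : (n : ℝ) ≤ d ^ (2 * k + 4) := by
    calc (n : ℝ) = √(n : ℝ) ^ 2 := hsq.symm
      _ ≤ (d ^ (k + 1 + 1)) ^ 2 := by gcongr
      _ = d ^ (2 * k + 4) := by ring
  refine ⟨k, ?_, hlow, hup⟩
  have hg : growth (Fin n) (edgeProb n) = 1 + d := by rw [growth_edgeProb hn, hd]
  -- taking logarithms in `d ^ (2 * k + 2) ≤ n`
  have hk : (2 * k : ℝ) * Real.log d ≤ d / 2 := by
    have e1 := Real.log_le_log (by positivity) hup
    rw [Real.log_pow] at e1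
    push_cast at e1
    rw [hd]
    rw [hd] at e1 hld
    linarith
  have hkd : (2 * k : ℝ) / d ≤ 1 / (2 * Real.log d) := by
    rw [div_le_div_iff₀ hd0 (by positivity)]
    linarith
  have hpow : (1 + d) ^ (2 * k) ≤ (1 + η) * d ^ (2 * k) := by
    have e1 : (1 + d) ^ (2 * k) = (1 / d + 1) ^ (2 * k) * d ^ (2 * k) := by
      rw [← mul_pow]
      congr 1
      field_simp
    rw [e1]
    refine mul_le_mul_of_nonneg_right ?_ (by positivity)
    calc (1 / d + 1) ^ (2 * k) ≤ Real.exp (1 / d) ^ (2 * k) := by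
          gcongr
          exact Real.add_one_le_exp _
      _ = Real.exp (2 * k / d) := by
          rw [← Real.exp_nat_mul]
          congr 1
          push_cast
          ring
      _ ≤ Real.exp (Real.log (1 + η)) := Real.exp_le_exp.2 (hkd.trans h3)
      _ = 1 + η := Real.exp_log (by linarith)
  have hpow2 : (1 + d) ^ (2 * k) ≤ 2 * d ^ (2 * k) :=
    hpow.trans (mul_le_mul_of_nonneg_right (by linarith) (by positivity))
  have hclose : (1 + d) ^ (2 * k + 1) / n ≤ 4 / d := by
    rw [div_le_div_iff₀ hn0 hd0]
    calc (1 + d) ^ (2 * k + 1) * d = (1 + d) ^ (2 * k) * (1 + d) * d := by ring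
      _ ≤ 2 * d ^ (2 * k) * (2 * d) * d := by
          gcongr
          linarith
      _ = 4 * d ^ (2 * k + 2) := by ring
      _ ≤ 4 * n := by linarith
  constructor
  · rw [hg]; linarith
  · exact hη
  · rw [hg]; simpa using hpow
  · rw [hg]
    refine le_trans ?_ h1
    rw [div_le_div_iff₀ (by linarith) hd0]
    linarith
  · rw [hg, Fintype.card_fin]
    calc (k : ℝ) * (2 * (1 + d) ^ (2 * k + 1) / n) = 2 * k * ((1 + d) ^ (2 * k + 1) / n) := by ring
      _ ≤ 2 * k * (4 / d) := by gcongr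
      _ = 4 * (2 * k / d) := by ring
      _ ≤ 4 * (1 / (2 * Real.log d)) := by gcongr
      _ = 2 / Real.log d := by field_simp; norm_num
      _ ≤ η := h2
  · rw [hg, Fintype.card_fin]
    exact hclose.trans h1
  · rw [hg, Fintype.card_fin, add_sub_cancel_left]
    have hs := (nat_sqrt_bounds hn).2
    have hsn : 0 < √(n : ℝ) := Real.sqrt_pos.2 hn0
    have e1 : d ^ k / √(n : ℝ) ≤ 1 / d := by
      rw [div_le_div_iff₀ hsn hd0]
      calc d ^ k * d = d ^ (k + 1) := by ring
        _ ≤ 1 * √(n : ℝ) := by linarith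
    calc (Nat.sqrt n : ℝ) * ((1 + d) ^ (2 * k) / n) ≤ √(n : ℝ) * (2 * d ^ (2 * k) / n) := by
          gcongr
      _ = √(n : ℝ) * (2 * d ^ (2 * k) / √(n : ℝ) ^ 2) := by rw [hsq]
      _ = 2 * d ^ k * (d ^ k / √(n : ℝ)) := by field_simp; ring
      _ ≤ 2 * d ^ k * (1 / d) := by gcongr
      _ = (2 / d) * d ^ k := by ring
      _ ≤ η * d ^ k := by
          gcongr
          refine le_trans ?_ h1
          gcongr
          norm_num

end Asymptotics

/-! ### The union bound and the limit -/

section Asymptotics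

open MeasureTheory ProbabilityTheory

/-- The union bound: the logarithm of the number of families of short labels is at most
`√n log n + n / (2 ^ 16 log ^ 3 n)`, which the exponent `n / (2 ^ 12 log ^ 3 n)` coming from the
open pairs exceeds by at least `log n`. -/
lemma union_bound_le {n l : ℝ} {s B K k : ℕ} (hl : l = Real.log n) (hn : 4 ≤ n) (hL : 3 ≤ l)
    (hLn : 10 ^ 4 * l ^ 4 ≤ √n) (hs1 : √n / 2 ≤ s) (hs2 : s ≤ √n) (hB1 : B + 1 ≤ n)
    (hB2 : B ≤ 1 / 2 ^ 18 * n / l ^ 4) (hK : (K : ℝ) + 1 ≤ n ^ 4)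
    (hlow : n ≤ (2 * l) ^ (2 * k + 4)) :
    ((B : ℝ) + 1) ^ s * ((K : ℝ) + 1) ^ B *
      Real.exp (-(2 * l / n * ((2 * l) ^ k / 4) ^ 2 * ((s : ℝ) ^ 2 / 8))) ≤ 1 / n := by
  have hn0 : 0 < n := by linarith
  have hl0 : 0 < l := by linarith
  have hsq : √n * √n = n := Real.mul_self_sqrt hn0.le
  have hsn : 0 < √n := Real.sqrt_pos.2 hn0
  have hnexp : n = Real.exp l := by rw [hl, Real.exp_log hn0]
  have e1 : ((B : ℝ) + 1) ^ s ≤ Real.exp (√n * l) := by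
    calc ((B : ℝ) + 1) ^ s ≤ n ^ s := pow_le_pow_left₀ (by positivity) hB1 s
      _ = Real.exp (s * l) := by rw [Real.exp_nat_mul, ← hnexp]
      _ ≤ _ := Real.exp_le_exp.2 (mul_le_mul_of_nonneg_right hs2 hl0.le)
  have e2 : ((K : ℝ) + 1) ^ B ≤ Real.exp (n / (2 ^ 16 * l ^ 3)) := by
    calc ((K : ℝ) + 1) ^ B ≤ (n ^ 4) ^ B := pow_le_pow_left₀ (by positivity) hK B
      _ = Real.exp (B * (4 * l)) := by
          rw [Real.exp_nat_mul, show (4 : ℝ) * l = (4 : ℕ) * l by norm_num, Real.exp_nat_mul,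
            ← hnexp]
      _ ≤ Real.exp (1 / 2 ^ 18 * n / l ^ 4 * (4 * l)) :=
          Real.exp_le_exp.2 (mul_le_mul_of_nonneg_right hB2 (by positivity))
      _ = _ := by congr 1; field_simp; norm_num
  have e3 : n / (2 ^ 12 * l ^ 3) ≤ 2 * l / n * ((2 * l) ^ k / 4) ^ 2 * ((s : ℝ) ^ 2 / 8) := by
    have f1 : n / 4 ≤ (s : ℝ) ^ 2 := by nlinarith
    have f2 : 1 / (2 * l) ^ 3 ≤ 2 * l / n * (2 * l) ^ (2 * k) := by
      rw [div_le_iff₀ (by positivity)]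
      calc (1 : ℝ) ≤ (2 * l) ^ (2 * k + 4) / n := by rw [one_le_div hn0]; exact hlow
        _ = 2 * l / n * (2 * l) ^ (2 * k) * (2 * l) ^ 3 := by ring
    calc n / (2 ^ 12 * l ^ 3) = 1 / (2 * l) ^ 3 * (n / 4) / 128 := by field_simp; norm_num
      _ ≤ 2 * l / n * (2 * l) ^ (2 * k) * (s : ℝ) ^ 2 / 128 := by gcongr
      _ = _ := by ring
  calc _ ≤ Real.exp (√n * l) * Real.exp (n / (2 ^ 16 * l ^ 3)) *
        Real.exp (-(n / (2 ^ 12 * l ^ 3))) :=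
        mul_le_mul (mul_le_mul e1 e2 (by positivity) (Real.exp_pos _).le)
          (Real.exp_le_exp.2 (neg_le_neg e3)) (Real.exp_pos _).le (by positivity)
    _ = Real.exp (√n * l + n / (2 ^ 16 * l ^ 3) - n / (2 ^ 12 * l ^ 3)) := by
        rw [← Real.exp_add, ← Real.exp_add, sub_eq_add_neg]
    _ ≤ Real.exp (-l) := by
        refine Real.exp_le_exp.2 ?_
        have g1 : 10 ^ 4 * (l * √n) ≤ n / l ^ 3 := by
          rw [le_div_iff₀ (by positivity)]
          calc 10 ^ 4 * (l * √n) * l ^ 3 = 10 ^ 4 * l ^ 4 * √n := by ring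
            _ ≤ √n * √n := mul_le_mul_of_nonneg_right hLn hsn.le
            _ = n := hsq
        have g2 : n / (2 ^ 16 * l ^ 3) = 1 / 2 ^ 16 * (n / l ^ 3) := by
          field_simp
        have g3 : n / (2 ^ 12 * l ^ 3) = 1 / 2 ^ 12 * (n / l ^ 3) := by
          field_simp
        have g4 : 1 ≤ √n := by rw [Real.one_le_sqrt]; linarith
        have g5 : l ≤ l * √n := le_mul_of_one_le_right hl0.le g4
        rw [g2, g3]
        linarith
    _ = 1 / n := by rw [Real.exp_neg, ← hnexp, one_div]

/-- The bound for short labelings with the block length `√n`, the number of blocks `√n` and the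
radius of `exists_radius` filled in. -/
lemma expect_short_labeling_le_mul {n : ℕ} {α : Type*} [Fintype α] (hα : Fintype.card α + 1 ≤ n ^ 4)
    (Q : Fin n → Fin n → List α → List α → ℕ∞) {η : ℝ} (hn : 4 ≤ n)
    (hL : 3 ≤ Real.log n) (hLn : 10 ^ 4 * Real.log n ^ 4 ≤ √(n : ℝ)) (hη : η ≤ 1)
    (h1 : 4 / (2 * Real.log n) ≤ η) (h2 : 2 / Real.log (2 * Real.log n) ≤ η)
    (h3 : 1 / (2 * Real.log (2 * Real.log n)) ≤ Real.log (1 + η)) (h4 : 1 / (n : ℝ) ≤ η) :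
    expect (edgeProb n) (fun G ↦ ind (∃ L : Fin n → List α,
      (∀ u v, Q u v (L u) (L v) = G.edist u v) ∧ ((∑ v, (L v).length : ℕ) : ℝ) ≤
        1 / 2 ^ 20 * ((n : ℝ) ^ (3 / 2 : ℝ) / Real.log n ^ 4))) ≤ 650 * η := by
  have hn0 : (0 : ℝ) < n := by exact_mod_cast (by omega : 0 < n)
  have hn4 : (4 : ℝ) ≤ n := by exact_mod_cast hn
  have hsn : 0 < √(n : ℝ) := Real.sqrt_pos.2 hn0
  have hsq : √(n : ℝ) * √(n : ℝ) = n := Real.mul_self_sqrt hn0.le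
  set l := Real.log n with hl
  have hl0 : 0 < l := by linarith
  have hl1 : 1 ≤ l := by linarith
  have hl4 : l ≤ l ^ 4 := le_self_pow₀ hl1 (by norm_num)
  obtain ⟨k, hS, hlow, hup⟩ := exists_radius (n := n) (d := 2 * l) (η := η) (by omega) rfl
    (by linarith) (by linarith) hη h1 h2 h3
  have hg : growth (Fin n) (edgeProb n) = 1 + 2 * l := growth_edgeProb (by omega)
  have hp : (edgeProb n : ℝ) = 2 * l / n := rfl
  obtain ⟨hs1, hs2⟩ := nat_sqrt_bounds (n := n) (by omega)
  have hs : 2 ≤ Nat.sqrt n := by rw [Nat.le_sqrt]; omega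
  have hs0 : (0 : ℝ) < Nat.sqrt n := by exact_mod_cast (by omega : 0 < Nat.sqrt n)
  obtain ⟨x, hx⟩ := exists_blocks (n := n) (m := Nat.sqrt n) (s := Nat.sqrt n) (Nat.sqrt_le n)
  have hrpow : (n : ℝ) ^ (3 / 2 : ℝ) = n * √(n : ℝ) := by
    rw [show (3 / 2 : ℝ) = 1 + 1 / 2 by norm_num, Real.rpow_add hn0, Real.rpow_one,
      Real.sqrt_eq_rpow]
  set T : ℝ := 1 / 2 ^ 20 * ((n : ℝ) ^ (3 / 2 : ℝ) / l ^ 4) with hT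
  have hT0 : 0 ≤ T := by positivity
  set s := Nat.sqrt n with hs_def
  set B := ⌊2 * T / s⌋₊ with hB
  have hB1 : 2 * T ≤ s * (B + 1) := by
    have := (Nat.lt_floor_add_one (2 * T / s)).le
    rw [div_le_iff₀ hs0] at this
    linarith
  have hB2 : (B : ℝ) ≤ 1 / 2 ^ 18 * n / l ^ 4 := by
    calc (B : ℝ) ≤ 2 * T / s := Nat.floor_le (by positivity)
      _ ≤ 2 * T / (√(n : ℝ) / 2) := by gcongr
      _ = 1 / 2 ^ 18 * n / l ^ 4 := by
          rw [hT, hrpow]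
          field_simp
  have hB3 : (B : ℝ) + 1 ≤ n := by
    have : 1 / 2 ^ 18 * n / l ^ 4 ≤ 1 / 2 ^ 18 * n := div_le_self (by positivity) (one_le_pow₀ hl1)
    linarith
  have hpd : (edgeProb n : ℝ) * (2 * l) ^ (2 * k) ≤ 1 / (2 * l) := by
    rw [hp, le_div_iff₀ (by positivity)]
    calc 2 * l / n * (2 * l) ^ (2 * k) * (2 * l) = (2 * l) ^ (2 * k + 2) / n := by ring
      _ ≤ 1 := by rw [div_le_one hn0]; exact hup
  have hhi : (edgeProb n : ℝ) * (3 / 2 * (growth (Fin n) (edgeProb n) - 1) ^ k) ^ 2 ≤ 1 / 2 := by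
    rw [hg, add_sub_cancel_left]
    have e1 : 1 / (2 * l) ≤ 1 / 6 := one_div_le_one_div_of_le (by norm_num) (by linarith)
    calc (edgeProb n : ℝ) * (3 / 2 * (2 * l) ^ k) ^ 2
        = 9 / 4 * (edgeProb n * (2 * l) ^ (2 * k)) := by ring
      _ ≤ 9 / 4 * (1 / 6) := by gcongr; exact hpd.trans e1
      _ ≤ 1 / 2 := by norm_num
  refine (expect_short_labeling_le Q (by omega) hs hx hB1 hS hhi).trans ?_
  rw [hg, add_sub_cancel_left]
  have hexp := union_bound_le rfl hn4 hL hLn hs1 hs2 hB3 hB2 (by exact_mod_cast hα) hlow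
  rw [← hp] at hexp
  have hη0 := hS.nonneg
  linarith

/-- With high probability no short labeling by words over a polynomially large alphabet recovers
all distances. -/
lemma tendsto_erdosRenyi_labeling (α : ℕ → Type) [∀ n, Fintype (α n)]
    (hα : ∀ᶠ n in atTop, Fintype.card (α n) + 1 ≤ n ^ 4)
    (Q : (n : ℕ) → Fin n → Fin n → List (α n) → List (α n) → ℕ∞) :
    Tendsto (fun n : ℕ ↦ erdosRenyi n {G : SimpleGraph (Fin n) |
      ∀ L : Fin n → List (α n), (∀ u v, Q n u v (L u) (L v) = G.edist u v) →
        1 / 2 ^ 20 * ((n : ℝ) ^ (3 / 2 : ℝ) / Real.log n ^ 4) ≤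
          ((∑ v, (L v).length : ℕ) : ℝ)}) atTop (𝓝 1) := by
  set bad : (n : ℕ) → SimpleGraph (Fin n) → Prop := fun n G ↦ ∃ L : Fin n → List (α n),
      (∀ u v, Q n u v (L u) (L v) = G.edist u v) ∧ ((∑ v, (L v).length : ℕ) : ℝ) ≤
        1 / 2 ^ 20 * ((n : ℝ) ^ (3 / 2 : ℝ) / Real.log n ^ 4)
  have hbad : Tendsto (fun n ↦ expect (edgeProb n) fun G ↦ ind (bad n G)) atTop (𝓝 0) := by
    rw [tendsto_order]
    refine ⟨fun a ha ↦ .of_forall fun n ↦ ha.trans_le (expect_nonneg fun G ↦ ind_nonneg _),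
      fun ε hε ↦ ?_⟩
    set η := min 1 (ε / 1000) with hη_def
    have hη0 : 0 < η := lt_min zero_lt_one (by positivity)
    have hη : 650 * η < ε := by
      have : η ≤ ε / 1000 := min_le_right _ _
      linarith
    have hlog : Tendsto (fun n : ℕ ↦ Real.log n) atTop atTop :=
      Real.tendsto_log_atTop.comp tendsto_natCast_atTop_atTop
    have h2log : Tendsto (fun n : ℕ ↦ 2 * Real.log n) atTop atTop := hlog.const_mul_atTop two_pos
    have hloglog : Tendsto (fun n : ℕ ↦ Real.log (2 * Real.log n)) atTop atTop :=
      Real.tendsto_log_atTop.comp h2log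
    have hpow : ∀ᶠ n : ℕ in atTop, 10 ^ 4 * Real.log n ^ 4 ≤ √(n : ℝ) := by
      have h := (Real.isLittleO_pow_log_id_atTop (n := 8)).comp_tendsto
        (tendsto_natCast_atTop_atTop (R := ℝ))
      filter_upwards [h.bound (c := 1 / 10 ^ 8) (by positivity)] with n hn
      simp only [Function.comp_apply, id_eq, Real.norm_eq_abs, Nat.abs_cast] at hn
      refine Real.le_sqrt_of_sq_le ?_
      have := le_abs_self (Real.log n ^ 8)
      calc (10 ^ 4 * Real.log n ^ 4 : ℝ) ^ 2 = 10 ^ 8 * Real.log n ^ 8 := by ring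
        _ ≤ 10 ^ 8 * (1 / 10 ^ 8 * (n : ℝ)) := by gcongr; exact this.trans hn
        _ = (n : ℝ) := by ring
    filter_upwards [hα, eventually_ge_atTop 4, hlog.eventually_ge_atTop 3, hpow,
      (h2log.const_div_atTop 4).eventually_le_const hη0,
      (hloglog.const_div_atTop 2).eventually_le_const hη0,
      ((hloglog.const_mul_atTop two_pos).const_div_atTop 1).eventually_le_const
        (Real.log_pos (by linarith : 1 < 1 + η)),
      (tendsto_natCast_atTop_atTop.const_div_atTop 1).eventually_le_const hη0]
      with n g1 g2 g3 g4 g5 g6 g7 g8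
    exact (expect_short_labeling_le_mul g1 (Q n) g2 g3 g4 (min_le_left _ _) g5 g6 g7 g8).trans_lt hη
  have hlow : Tendsto (fun n ↦ ENNReal.ofReal
      (1 - expect (edgeProb n) fun G ↦ ind (bad n G))) atTop (𝓝 1) := by
    have := ENNReal.tendsto_ofReal (hbad.const_sub 1)
    simpa using this
  have hprob : ∀ n, IsProbabilityMeasure (erdosRenyi n) := fun n ↦ by
    unfold erdosRenyi; infer_instance
  refine tendsto_of_tendsto_of_tendsto_of_le_of_le hlow tendsto_const_nhds (fun n ↦ ?_)
    fun n ↦ prob_le_one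
  have h1 : 1 - expect (edgeProb n) (fun G ↦ ind (bad n G)) =
      (erdosRenyi n).real {G | ¬ bad n G} := by
    rw [erdosRenyi, measureReal_eq_expect]
    simp only [ind_not]
    rw [expect_sub, expect_const]
  rw [h1, ofReal_measureReal]
  refine measure_mono fun G hG L hL ↦ ?_
  by_contra hlt
  exact hG ⟨L, hL, (not_le.1 hlt).le⟩

end Asymptotics

/-! ### 2-hop covers as labelings -/

section TwoHop

open MeasureTheory ProbabilityTheory

/-- A landmark entry of a label: the landmark, its distance (`none` encoding `⊤`), and whether it is
a forward and whether it is a backward landmark. -/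
abbrev LandmarkEntry (n : ℕ) : Type := Fin n × Option (Fin n) × Bool × Bool

/-- The distance stored in a landmark entry. -/
def LandmarkEntry.dist {n : ℕ} (a : LandmarkEntry n) : ℕ∞ :=
  a.2.1.elim ⊤ fun i ↦ ((i : ℕ) : ℕ∞)

/-- The query procedure of a 2-hop cover, on labels that list the landmarks. -/
noncomputable def hopQuery {n : ℕ} (l l' : List (LandmarkEntry n)) : ℕ∞ :=
  ⨅ (a ∈ l) (b ∈ l') (_ : a.1 = b.1 ∧ a.2.2.1 = true ∧ b.2.2.2 = true), a.dist + b.dist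

lemma exists_option_edist {n : ℕ} (G : SimpleGraph (Fin n)) (x z : Fin n) :
    ∃ o : Option (Fin n), o.elim (⊤ : ℕ∞) (fun i ↦ ((i : ℕ) : ℕ∞)) = G.edist x z := by
  by_cases h : G.Reachable x z
  · obtain ⟨w, hw, hlen⟩ := h.exists_path_of_dist
    have hlt := hw.length_lt
    rw [Fintype.card_fin] at hlt
    exact ⟨some ⟨G.dist x z, hlen ▸ hlt⟩, h.coe_dist_eq_edist⟩
  · exact ⟨none, (SimpleGraph.edist_eq_top_of_not_reachable h).symm⟩

/-- A 2-hop cover is a labeling with one letter for each landmark stored. -/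
lemma exists_labeling_of_isTwoHopCover {n : ℕ} {G : SimpleGraph (Fin n)}
    {LF LB : Fin n → Finset (Fin n)} (h : IsTwoHopCover G LF LB) :
    ∃ L : Fin n → List (LandmarkEntry n), (∀ x y, hopQuery (L x) (L y) = G.edist x y) ∧
      ∑ x, (L x).length = numLandmarks LF LB := by
  choose o ho using exists_option_edist G
  refine ⟨fun x ↦ (LF x ∪ LB x).toList.map fun z ↦
    (z, o x z, decide (z ∈ LF x), decide (z ∈ LB x)), fun x y ↦ ?_, ?_⟩
  · rw [← h x y, hopQuery]
    apply le_antisymm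
    · refine Finset.le_inf fun z hz ↦ ?_
      rw [Finset.mem_inter] at hz
      refine (iInf₂_le (z, o x z, decide (z ∈ LF x), decide (z ∈ LB x)) ?_).trans
        ((iInf₂_le (z, o y z, decide (z ∈ LF y), decide (z ∈ LB y)) ?_).trans
          ((iInf_le _ ⟨rfl, by simpa using hz.1, by simpa using hz.2⟩).trans (le_of_eq ?_)))
      · exact List.mem_map.2 ⟨z, by simp [hz.1], rfl⟩
      · exact List.mem_map.2 ⟨z, by simp [hz.2], rfl⟩
      · exact congrArg₂ (· + ·) (ho x z) ((ho y z).trans SimpleGraph.edist_comm)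
    · refine le_iInf₂ fun a ha ↦ le_iInf₂ fun b hb ↦ le_iInf fun hab ↦ ?_
      obtain ⟨z, -, rfl⟩ := List.mem_map.1 ha
      obtain ⟨z', -, rfl⟩ := List.mem_map.1 hb
      obtain ⟨rfl, hF, hB⟩ := hab
      simp only [decide_eq_true_eq] at hF hB
      refine (Finset.inf_le (Finset.mem_inter.2 ⟨hF, hB⟩)).trans (le_of_eq ?_)
      exact (congrArg₂ (· + ·) (ho x z) ((ho y z).trans SimpleGraph.edist_comm)).symm
  · simp [numLandmarks]

lemma eventually_card_landmarkEntry_le :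
    ∀ᶠ n : ℕ in atTop, Fintype.card (LandmarkEntry n) + 1 ≤ n ^ 4 := by
  filter_upwards [eventually_ge_atTop 3] with n hn
  simp only [LandmarkEntry, Fintype.card_prod, Fintype.card_fin, Fintype.card_option,
    Fintype.card_bool]
  nlinarith [Nat.mul_le_mul hn hn, Nat.mul_le_mul (Nat.mul_le_mul hn hn) (Nat.mul_le_mul hn hn)]

end TwoHop

theorem mainTheorem2 :
    ∃ c : ℝ, 0 < c ∧
      (∀ Q : (n : ℕ) → LabelQuery (Fin n),
        Tendsto (fun n : ℕ ↦ erdosRenyi n {G : SimpleGraph (Fin n) |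
            ∀ L : Fin n → List Bool, RecoversDistances (Q n) G L →
              c * ((n : ℝ) ^ (3 / 2 : ℝ) / Real.log n ^ 4) ≤ (totalLength L : ℝ)})
          atTop (𝓝 1)) ∧
      Tendsto (fun n : ℕ ↦ erdosRenyi n {G : SimpleGraph (Fin n) |
          ∀ LF LB : Fin n → Finset (Fin n), IsTwoHopCover G LF LB →
            c * ((n : ℝ) ^ (3 / 2 : ℝ) / Real.log n ^ 4) ≤ (numLandmarks LF LB : ℝ)})
        atTop (𝓝 1) := by
  refine ⟨1 / 2 ^ 20, by positivity, fun Q ↦ ?_, ?_⟩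
  · refine tendsto_erdosRenyi_labeling (fun _ ↦ Bool) ?_ Q
    filter_upwards [eventually_ge_atTop 2] with n hn
    rw [Fintype.card_bool]
    exact (by norm_num : 2 + 1 ≤ 2 ^ 4).trans (Nat.pow_le_pow_left hn 4)
  · have h := tendsto_erdosRenyi_labeling LandmarkEntry eventually_card_landmarkEntry_le
      fun n _ _ l l' ↦ hopQuery l l'
    have hprob : ∀ n, MeasureTheory.IsProbabilityMeasure (erdosRenyi n) := fun n ↦ by
      unfold erdosRenyi; infer_instance
    refine tendsto_of_tendsto_of_tendsto_of_le_of_le h tendsto_const_nhds (fun n ↦ ?_)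
      fun n ↦ MeasureTheory.prob_le_one
    refine MeasureTheory.measure_mono fun G hG LF LB hcover ↦ ?_
    obtain ⟨L, hL, hlen⟩ := exists_labeling_of_isTwoHopCover hcover
    rw [← hlen]
    exact hG L hL
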